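/- **Setting.** Let $d\ge 1$, $L>0$, let $N\ge 2$ be even, $\rho=N/L^d$, $0\neq \mathbf j_*\in\mathbb Z^d$ and $\phi>0$. Put $k_{\mathbf j}=\frac{2\pi}{L}\mathbf j$ and let $a_{\mathbf j},a^*_{\mathbf j}$ be the bosonic annihilation and creation operators of the plane-wave modes on the torus of side $L$. On the $N$-particle sector $\mathcal F^N$ of the Fock space consider the three-modes Bogoliubov Hamiltonian $$H=\sum_{\mathbf j\ne\pm\mathbf j_*}k_{\mathbf j}^2a^*_{\mathbf j}a_{\mathbf j}+\sum_{\mathbf j=\pm\mathbf j_*}\Big(k_{\mathbf j}^2+\phi\,\tfrac{a_{\mathbf 0}^*a_{\mathbf 0}}{N}\Big)a^*_{\mathbf j}a_{\mathbf j}+W+W^*,\qquad W=\phi\,\frac{a^*_{\mathbf 0}a^*_{\mathbf 0}a_{\mathbf j_*}a_{-\mathbf j_*}}{N}.$$ Put $\epsilon=k_{\mathbf j_*}^2/\phi$, $E^{Bog}_{\mathbf j_*}=-\big[k_{\mathbf j_*}^2+\phi-\sqrt{(k_{\mathbf j_*}^2)^2+2\phi k_{\mathbf j_*}^2}\,\big]$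 and $z_{\max}=E^{Bog}_{\mathbf j_*}+\sqrt\epsilon\,\phi\sqrt{\epsilon^2+2\epsilon}$. For even $i$ with $0\le i\le N-2$ let $Q_i$ be the orthogonal projection onto the vectors with $N-i$ or $N-i-1$ particles in the modes $\pm\mathbf j_*$, and for $z\in\mathbb R$ let $R_i(z)=Q_i\,(Q_i(H-z)Q_i)^{-1}Q_i$, $\Gamma_0(z)=0$ and $$\Gamma_{i+2}(z)=Q_{i+2}WQ_i\,R_i(z)\sum_{l\ge0}[\Gamma_i(z)R_i(z)]^l\,Q_iW^*Q_{i+2}.$$ With $\eta$ the normalized state having all $N$ particles in the zero mode, let $$f(z)=-z-\Big\langle\eta,\;W R_{N-2}(z)\sum_{l\ge0}[\Gamma_{N-2}(z)R_{N-2}(z)]^l\,W^*\eta\Big\rangle .$$ The function $f$ is called well defined at $z$ if all the $R_i(z)$ exist as bounded operators and all the series $\sum_l[\Gamma_i(z)R_i(z)]^l$, $0\le i\le N-2$, converge in operator norm. For $0<\gamma<1$ and $k_\gamma>0$ consider the condition $$(\ast)\qquad \epsilon^2+\frac{\epsilon}{N^\gamma}+\frac1N\le k_\gamma\,\epsilon\sqrt\epsilon,\qquad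 \frac1{N^{1-\gamma}}\le k_\gamma\,\epsilon .$$ **Statement.** 1. There are absolute constants $c,C>0$ such that for every $\gamma\in(0,1)$ there are $\epsilon_0,k_\gamma>0$ (depending only on $\gamma$) with the following properties. If $\epsilon\le\epsilon_0$ and $(\ast)$ holds, then $f$ is well defined on $(-\infty,z_{\max}]$ and has exactly one zero $z_*$ there. Moreover, for every $\beta\in(0,1)$ there is $\tau>0$ (depending only on $\gamma,\beta$) such that, if in addition $\frac1{N^\beta}\le\tau\epsilon$ and $\frac1{N^{1-\beta}}\le\tau\sqrt\epsilon$ (in particular, eventually in every regime in which $\frac1{N^\beta}=o(\epsilon)$ and $\frac1{N^{1-\beta}}=o(\sqrt\epsilon)$), then $$|z_*-E^{Bog}_{\mathbf j_*}|\le C\,\phi\left(\frac1{\epsilon N^\beta}+\frac1{\sqrt\epsilon}\Big[\frac1{1+c\sqrt\epsilon}\Big]^{N^{1-\beta}}+\frac1N\right).$$ 2. (Mean-field limit.) There is an absolute constant $\epsilon_0>0$ such that, if $d,L,\mathbf j_*,\phi$ are fixed with $\epsilon\le\epsilon_0$ and $N\to\infty$ along even integers, then eventually $f$ is well defined on $(-\infty,z_{\max}]$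 and has exactly one zero $z_*$ there, and $z_*\to E^{Bog}_{\mathbf j_*}$. 3. (Fixed density.) If $d\ge4$ and $\rho,\mathbf j_*,\phi$ are fixed, and $L\to\infty$ with $N=\rho L^d$ an even integer, then eventually $f$ is well defined on $(-\infty,z_{\max}]$ and has exactly one zero $z_*$ there, and $z_*-E^{Bog}_{\mathbf j_*}\to0$. -/

import Mathlib

open Filter Topology

noncomputable section

namespace BogoliubovThreeModes

/-- Mode labels: the lattice of integer vectors of length `d`; the label `k` stands for the plane wave
with wave vector `(2π / L) k` on the torus of side `L`. -/
abbrev Mode (d : ℕ) : Type := Fin d → ℤ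

/-- Occupation-number configurations with `N` particles in total. -/
abbrev Occ (d N : ℕ) : Type := {n : Mode d →₀ ℕ // n.degree = N}

/-- The `N`-particle sector of the bosonic Fock space over the square-integrable functions on the
torus, in the occupation-number representation with respect to the plane waves:
`ψ n` is the coefficient of `ψ` along the normalized product state with occupation numbers `n`. -/
abbrev FockN (d N : ℕ) : Type := lp (fun _ : Occ d N => ℂ) 2

variable {d : ℕ}

/-- The coefficient of `ψ` at an arbitrary configuration (zero unless it has `N` particles). -/
def amp {N : ℕ} (ψ : FockN d N) (n : Mode d →₀ ℕ) : ℂ :=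
  if h : n.degree = N then ψ ⟨n, h⟩ else 0

theorem amp_add {N : ℕ} (ψ χ : FockN d N) (n : Mode d →₀ ℕ) :
    amp (ψ + χ) n = amp ψ n + amp χ n := by
  by_cases h : n.degree = N <;> simp [amp, h]

theorem amp_smul {N : ℕ} (c : ℂ) (ψ : FockN d N) (n : Mode d →₀ ℕ) :
    amp (c • ψ) n = c * amp ψ n := by
  by_cases h : n.degree = N <;> simp [amp, h]

/-- `(a_k ψ)(n) = √(n_k + 1) ψ(n + δ_k)`. -/
def annihFun {N : ℕ} (k : Mode d) (ψ : FockN d N) (n : Occ d (N - 1)) : ℂ :=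
  (Real.sqrt ((n.1 k : ℝ) + 1) : ℂ) * amp ψ (n.1 + Finsupp.single k 1)

theorem annihFun_finset {N : ℕ} (k : Mode d) (ψ : FockN d N) (s : Finset (Occ d (N - 1))) :
    ∑ n ∈ s, ‖annihFun k ψ n‖ ^ 2 ≤ (N : ℝ) * ‖ψ‖ ^ 2 := by
  classical
  rcases Nat.eq_zero_or_pos N with hN | hN
  · have h0 : ∀ n : Occ d (N - 1), annihFun k ψ n = 0 := by
      intro n
      have : (n.1 + Finsupp.single k 1).degree ≠ N := by
        rw [map_add, Finsupp.degree_single]; omega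
      rw [annihFun, amp, dif_neg this, mul_zero]
    simp only [h0, norm_zero]
    simp only [ne_eq, OfNat.ofNat_ne_zero, not_false_eq_true, zero_pow, Finset.sum_const_zero]
    positivity
  · have hdeg : ∀ n : Occ d (N - 1), (n.1 + Finsupp.single k 1).degree = N := by
      intro n
      rw [map_add, Finsupp.degree_single, n.2]; omega
    let g : Occ d (N - 1) → Occ d N := fun n => ⟨n.1 + Finsupp.single k 1, hdeg n⟩
    have hg : Function.Injective g := by
      intro a b hab
      have h1 : a.1 + Finsupp.single k 1 = b.1 + Finsupp.single k 1 := congrArg Subtype.val hab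
      exact Subtype.ext (add_right_cancel h1)
    have hterm : ∀ n : Occ d (N - 1), ‖annihFun k ψ n‖ ^ 2 ≤ (N : ℝ) * ‖ψ (g n)‖ ^ 2 := by
      intro n
      have hk : (n.1 k : ℝ) + 1 ≤ N := by
        have h1 : n.1 k ≤ n.1.degree := Finsupp.le_degree k n.1
        have h2 := n.2
        have h3 : n.1 k + 1 ≤ N := by omega
        exact_mod_cast h3
      have h0 : (0 : ℝ) ≤ (n.1 k : ℝ) + 1 := by positivity
      have hamp : amp ψ (n.1 + Finsupp.single k 1) = ψ (g n) := by
        simp only [amp, hdeg n, dite_true, g]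
      rw [annihFun, hamp, norm_mul, mul_pow, Complex.norm_real, Real.norm_eq_abs, sq_abs,
        Real.sq_sqrt h0]
      exact mul_le_mul_of_nonneg_right hk (by positivity)
    have hsum : ∑ m ∈ s.image g, ‖ψ m‖ ^ 2 ≤ ‖ψ‖ ^ 2 := by
      have h := lp.sum_rpow_le_norm_rpow (p := 2) (by norm_num) ψ (s.image g)
      simpa using h
    calc ∑ n ∈ s, ‖annihFun k ψ n‖ ^ 2 ≤ ∑ n ∈ s, (N : ℝ) * ‖ψ (g n)‖ ^ 2 :=
          Finset.sum_le_sum fun n _ => hterm n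
      _ = (N : ℝ) * ∑ m ∈ s.image g, ‖ψ m‖ ^ 2 := by
          rw [← Finset.mul_sum, Finset.sum_image fun a _ b _ h => hg h]
      _ ≤ (N : ℝ) * ‖ψ‖ ^ 2 := mul_le_mul_of_nonneg_left hsum (by positivity)

theorem annihFun_memlp {N : ℕ} (k : Mode d) (ψ : FockN d N) :
    Memℓp (E := fun _ : Occ d (N - 1) => ℂ) (annihFun k ψ) 2 := by
  refine memℓp_gen' (C := (N : ℝ) * ‖ψ‖ ^ 2) fun s => ?_
  simpa using annihFun_finset k ψ s

/-- The annihilation operator `a_k` from the `N`-particle to the `(N - 1)`-particle sector (for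
`N = 0` it is the zero operator). -/
def annih (N : ℕ) (k : Mode d) : FockN d N →L[ℂ] FockN d (N - 1) :=
  LinearMap.mkContinuous
    { toFun := fun ψ => ⟨annihFun k ψ, annihFun_memlp k ψ⟩
      map_add' := by
        intro ψ χ
        ext n
        change annihFun k (ψ + χ) n = annihFun k ψ n + annihFun k χ n
        rw [annihFun, amp_add, mul_add, annihFun, annihFun]
      map_smul' := by
        intro c ψ
        ext n
        change annihFun k (c • ψ) n = c * annihFun k ψ n
        rw [annihFun, amp_smul, mul_left_comm, annihFun] }
    (Real.sqrt N)
    (by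
      intro ψ
      refine lp.norm_le_of_forall_sum_le (p := 2) (by norm_num) (by positivity) fun s => ?_
      have h := annihFun_finset k ψ s
      have e : (Real.sqrt N * ‖ψ‖) ^ 2 = (N : ℝ) * ‖ψ‖ ^ 2 := by
        rw [mul_pow, Real.sq_sqrt (by positivity)]
      simpa [e] using h)

/-- The creation operator `a_k^*`, the adjoint of `a_k`. -/
def creat (N : ℕ) (k : Mode d) : FockN d (N - 1) →L[ℂ] FockN d N :=
  ContinuousLinearMap.adjoint (annih N k)

/-- The number operator `a_k^* a_k` on the `N`-particle sector. -/
def num (N : ℕ) (k : Mode d) : FockN d N →L[ℂ] FockN d N := creat N k ∘L annih N k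

/-- `R` is the inverse of the compression `Q (H - z) Q` on the range of `Q`, extended by zero to the
orthogonal complement. -/
def IsCompressedResolvent {E : Type*} [NormedAddCommGroup E] [InnerProductSpace ℂ E]
    (H : E →ₗ.[ℂ] E) (Q : E →L[ℂ] E) (z : ℝ) (R : E →L[ℂ] E) : Prop :=
  Q ∘L R = R ∧ R ∘L Q = R ∧
  (∀ ψ : E, ∃ h : R ψ ∈ H.domain, Q (H ⟨R ψ, h⟩ - (z : ℂ) • R ψ) = Q ψ) ∧
  (∀ ψ : H.domain, Q (ψ : E) = ψ → R (Q (H ψ - (z : ℂ) • (ψ : E))) = ψ)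

open Classical in
/-- The operator `Q (Q (H - z) Q)⁻¹ Q` (zero if the compression is not boundedly invertible). -/
def compressedResolvent {E : Type*} [NormedAddCommGroup E] [InnerProductSpace ℂ E]
    (H : E →ₗ.[ℂ] E) (Q : E →L[ℂ] E) (z : ℝ) : E →L[ℂ] E :=
  if h : ∃ R, IsCompressedResolvent H Q z R then h.choose else 0

end BogoliubovThreeModes

open BogoliubovThreeModes

/-- The data of the three-modes system: `N` (even) bosons in a periodic box of side `L` in dimension
`d`, interacting through a pair potential whose only nonzero Fourier components (apart from the zero
mode, which plays no role) are `φ_j = φ_{-j} = φ > 0` for the nonzero mode label `j`. -/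
structure ThreeModeSystem (d : ℕ) where
  L : ℝ
  N : ℕ
  j : Mode d
  φ : ℝ
  L_pos : 0 < L
  N_pos : 0 < N
  N_even : Even N
  j_ne : j ≠ 0
  φ_pos : 0 < φ

namespace ThreeModeSystem

variable {d : ℕ} (S : ThreeModeSystem d)

/-- The kinetic energy `|k|² = |(2π / L) k|²` of a mode (units `ħ = 1`, `m = 1/2`). -/
def kin (k : Mode d) : ℝ := ∑ i, (2 * Real.pi / S.L * (k i : ℝ)) ^ 2

/-- The ratio `ε` between the kinetic energy of the interacting modes and the potential. -/
def eps : ℝ := S.kin S.j / S.φ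

/-- The Bogoliubov energy. -/
def EBog : ℝ :=
  -(S.kin S.j + S.φ - Real.sqrt (S.kin S.j ^ 2 + 2 * S.φ * S.kin S.j))

/-- The upper end `E^Bog + √ε φ √(ε² + 2 ε)` of the range of the spectral parameter. -/
def zMax : ℝ :=
  S.EBog + Real.sqrt S.eps * S.φ * Real.sqrt (S.eps ^ 2 + 2 * S.eps)

/-- The particle density. -/
def density : ℝ := S.N / S.L ^ d

/-- The Hilbert space of the system. -/
abbrev Space : Type := FockN d S.N

/-- The interaction term `W = φ a_0^* a_0^* a_j a_{-j} / N`. -/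
def W : S.Space →L[ℂ] S.Space :=
  ((S.φ / S.N : ℝ) : ℂ) •
    (creat S.N 0 ∘L creat (S.N - 1) 0 ∘L annih (S.N - 1) S.j ∘L annih S.N (-S.j))

/-- The interaction term `W^* = φ a_j^* a_{-j}^* a_0 a_0 / N`. -/
def Wstar : S.Space →L[ℂ] S.Space :=
  ((S.φ / S.N : ℝ) : ℂ) •
    (creat S.N S.j ∘L creat (S.N - 1) (-S.j) ∘L annih (S.N - 1) 0 ∘L annih S.N 0)

/-- `Ĥ⁰ = ∑_{±} (k_j² + φ a_0^* a_0 / N) a_{±j}^* a_{±j}`. -/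
def H0hat : S.Space →L[ℂ] S.Space :=
  ((S.kin S.j : ℂ) • ContinuousLinearMap.id ℂ S.Space + ((S.φ / S.N : ℝ) : ℂ) • num S.N 0) ∘L
    (num S.N S.j + num S.N (-S.j))

/-- The kinetic energy of a configuration in the modes other than `j` and `-j`. -/
def kinRest (n : Occ d S.N) : ℝ :=
  ∑ k ∈ n.1.support \ {S.j, -S.j}, S.kin k * (n.1 k : ℝ)

/-- The kinetic energy operator `∑_{k ≠ ±j} k² a_k^* a_k`, with its maximal domain. -/
def kineticRest : S.Space →ₗ.[ℂ] S.Space where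
  domain :=
    { carrier := {ψ | Memℓp (E := fun _ : Occ d S.N => ℂ)
        (fun n => (S.kinRest n : ℂ) * ψ n) 2}
      add_mem' := by
        intro ψ χ hψ hχ
        have h := Memℓp.add hψ hχ
        have e : (fun n => (S.kinRest n : ℂ) * (ψ + χ) n) =
            (fun n => (S.kinRest n : ℂ) * ψ n) + fun n => (S.kinRest n : ℂ) * χ n := by
          funext n
          simp [mul_add]
        simpa only [Set.mem_ofPred_eq, e] using h
      zero_mem' := by
        have e : (fun n => (S.kinRest n : ℂ) * (0 : S.Space) n) = 0 := by
          funext n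
          simp
        simpa only [Set.mem_ofPred_eq, e] using
          (zero_memℓp : Memℓp (0 : ∀ _ : Occ d S.N, ℂ) 2)
      smul_mem' := by
        intro c ψ hψ
        have h := Memℓp.const_smul hψ c
        have e : (fun n => (S.kinRest n : ℂ) * (c • ψ) n) =
            c • fun n => (S.kinRest n : ℂ) * ψ n := by
          funext n
          simp [mul_left_comm]
        simpa only [Set.mem_ofPred_eq, e] using h }
  toFun :=
    { toFun := fun ψ => ⟨fun n => (S.kinRest n : ℂ) * (ψ : S.Space) n, ψ.2⟩
      map_add' := by
        intro ψ χ
        ext n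
        exact mul_add (S.kinRest n : ℂ) ((ψ : S.Space) n) ((χ : S.Space) n)
      map_smul' := by
        intro c ψ
        ext n
        exact mul_left_comm (S.kinRest n : ℂ) c ((ψ : S.Space) n) }

/-- The Bogoliubov Hamiltonian `H^Bog_j = ∑_{k ≠ ±j} k² a_k^* a_k + Ĥ⁰ + W + W^*` of the three-modes
system on the `N`-particle sector. -/
def HBog : S.Space →ₗ.[ℂ] S.Space where
  domain := S.kineticRest.domain
  toFun := S.kineticRest.toFun +
    ((S.H0hat + S.W + S.Wstar).toLinearMap ∘ₗ S.kineticRest.domain.subtype)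

/-- The closed subspace of vectors with exactly `N - i` or `N - i - 1` particles in the modes
`±j`. -/
def sector (i : ℕ) : Submodule ℂ S.Space where
  carrier := {ψ | ∀ n : Occ d S.N,
    n.1 S.j + n.1 (-S.j) + i ≠ S.N → n.1 S.j + n.1 (-S.j) + i + 1 ≠ S.N → ψ n = 0}
  add_mem' := by
    intro ψ χ hψ hχ n h1 h2
    simp [hψ n h1 h2, hχ n h1 h2]
  zero_mem' := by
    intro n _ _
    simp
  smul_mem' := by
    intro c ψ hψ n h1 h2
    simp [hψ n h1 h2]

theorem sector_isClosed (i : ℕ) : IsClosed (S.sector i : Set S.Space) := by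
  have e : (S.sector i : Set S.Space) = ⋂ n : Occ d S.N, {ψ : S.Space |
      n.1 S.j + n.1 (-S.j) + i ≠ S.N → n.1 S.j + n.1 (-S.j) + i + 1 ≠ S.N → ψ n = 0} := by
    ext ψ
    simp [sector]
  rw [e]
  refine isClosed_iInter fun n => ?_
  by_cases h1 : n.1 S.j + n.1 (-S.j) + i ≠ S.N
  · by_cases h2 : n.1 S.j + n.1 (-S.j) + i + 1 ≠ S.N
    · simp only [h1, h2, ne_eq, not_false_eq_true, forall_const]
      exact isClosed_eq (lp.evalCLM ℂ (fun _ : Occ d S.N => ℂ) 2 n).continuous continuous_const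
    · simp [h2]
  · simp [h1]

instance sector_hasOrthogonalProjection (i : ℕ) : (S.sector i).HasOrthogonalProjection :=
  haveI : CompleteSpace (S.sector i) := (S.sector_isClosed i).completeSpace_coe
  inferInstance

/-- The orthogonal projection `Q^{(i,i+1)}`. -/
def Q (i : ℕ) : S.Space →L[ℂ] S.Space := (S.sector i).starProjection

/-- `R_{i,i}(z) = Q^{(i,i+1)} (Q^{(i,i+1)} (H^Bog - z) Q^{(i,i+1)})⁻¹ Q^{(i,i+1)}`. -/
def R (i : ℕ) (z : ℝ) : S.Space →L[ℂ] S.Space := compressedResolvent S.HBog (S.Q i) z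

/-- The effective interaction of the Feshbach-Schur flow: `Gam z m` is `Γ_{i,i}(z)` for `i = 2 m`,
given by `Γ_{0,0} = 0` and
`Γ_{i+2,i+2} = W_{i+2,i} R_{i,i} (∑_l [Γ_{i,i} R_{i,i}]^l) W^*_{i,i+2}`, where
`W_{i+2,i} = Q^{(i+2,i+3)} W Q^{(i,i+1)}` and `W^*_{i,i+2} = Q^{(i,i+1)} W^* Q^{(i+2,i+3)}`.
The series is a sum in operator norm. -/
def Gam (z : ℝ) : ℕ → (S.Space →L[ℂ] S.Space)
  | 0 => 0
  | m + 1 =>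
    (S.Q (2 * m + 2) * S.W * S.Q (2 * m)) * S.R (2 * m) z *
      (∑' l : ℕ, (Gam z m * S.R (2 * m) z) ^ l) *
      (S.Q (2 * m) * S.Wstar * S.Q (2 * m + 2))

/-- All steps `i = 0, 2, …, N - 2` of the flow are well defined at `z`: the compressed resolvents
exist and the Neumann series converge in operator norm. -/
def FlowDefined (z : ℝ) : Prop :=
  ∀ i : ℕ, Even i → i + 2 ≤ S.N →
    (∃ T, IsCompressedResolvent S.HBog (S.Q i) z T) ∧
    Summable fun l : ℕ => (S.Gam z (i / 2) * S.R i z) ^ l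

open Classical in
/-- The state `η` with all `N` particles in the zero mode. -/
def eta : S.Space :=
  lp.single 2 (⟨Finsupp.single 0 S.N, Finsupp.degree_single 0 S.N⟩ : Occ d S.N) (1 : ℂ)

/-- The function `f(z) = -z - ⟨η, W R_{N-2,N-2}(z) ∑_l [Γ_{N-2,N-2}(z) R_{N-2,N-2}(z)]^l W^* η⟩`
(the inner product is real; the last Feshbach-Schur Hamiltonian is `f(z) |η⟩⟨η|`). -/
def f (z : ℝ) : ℝ :=
  -z - (inner ℂ S.eta
    ((S.W * S.R (S.N - 2) z *
      (∑' l : ℕ, (S.Gam z ((S.N - 2) / 2) * S.R (S.N - 2) z) ^ l) * S.Wstar) S.eta)).re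

/-- `z` is a zero of `f` in the admissible range. -/
def IsFixedPoint (z : ℝ) : Prop := z ≤ S.zMax ∧ S.f z = 0

/-- The point `z_*`: the zero of `f` in the admissible range (meaningful when it is unique). -/
def zStar : ℝ := Classical.epsilon S.IsFixedPoint

/-- `f` is well defined on the admissible range and has exactly one zero there. -/
def HasFixedPoint : Prop :=
  (∀ z : ℝ, z ≤ S.zMax → S.FlowDefined z) ∧ ∃! z : ℝ, S.IsFixedPoint z

/-- The smallness condition on `ε` and `1 / N` with parameters `γ` and `κ`. -/
def GammaCondition (γ κ : ℝ) : Prop :=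
  S.eps ^ 2 + S.eps / (S.N : ℝ) ^ γ + 1 / (S.N : ℝ) ≤ κ * (S.eps * Real.sqrt S.eps) ∧
  1 / (S.N : ℝ) ^ (1 - γ) ≤ κ * S.eps

end ThreeModeSystem

end

/-! Everything reduces to scalars in the occupation-number basis. `W` and `W^*` change the number of
particles in the modes ±j by two, while a sector contains only two consecutive values of it; hence
the compression of H - z to a sector is diagonal and, for z < 0, is inverted entry by entry.
Moreover `W^*` sends a basis vector to a multiple of a single basis vector and `W` brings it back,
so W T W^* is diagonal whenever T is. The Feshbach-Schur flow thus becomes the recursion `schur`,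
and f(z) is a finite continued fraction along the configurations with 0, 1, 2, ... pairs
(`f_eq_schur`).

Write b = `gap`. If the zero-mode occupation is frozen at N and z = E^Bog = -φ(1+ε-b), the recursion
in units of φ reads G_p = 2p(1+ε) + (1+ε-b) - (p+1)²/G_{p+1}. Since (1+ε-b)(1+ε+b) = 1, it is solved
by G_p = p(1+ε+b), which vanishes at p = 0: this is why E^Bog is nearly a zero of f.

Perturbations of this solution control the true recursion. `bogoliubov_supersolution` gives positive
lower bounds for all z ≤ `zMax`, hence convergent Neumann series; `bogoliubov_supersolution_even`
gives f(E^Bog) ≥ 0; `bogoliubov_subsolution` gives f(E^Bog + φ `shift`) ≤ 0, where `shift` is at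
most 5/(N√ε). As f is continuous and strictly decreasing, it has exactly one zero, lying between
these two points. The resulting error 5φ/(N√ε) is already below the first term of the claimed bound,
and it yields both limits. -/

namespace BogoliubovThreeModes

variable {d : ℕ}

/-! ### Creation and annihilation operators in occupation-number coordinates -/

theorem amp_val {N : ℕ} (ψ : FockN d N) (n : Occ d N) : amp ψ n.1 = ψ n := by
  simp [amp, n.2]

theorem amp_of_degree_ne {N : ℕ} (ψ : FockN d N) {n : Mode d →₀ ℕ} (h : n.degree ≠ N) :
    amp ψ n = 0 := by
  simp [amp, h]

theorem amp_sub {N : ℕ} (ψ χ : FockN d N) (n : Mode d →₀ ℕ) :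
    amp (ψ - χ) n = amp ψ n - amp χ n := by
  by_cases h : n.degree = N <;> simp [amp, h]

theorem amp_ext {N : ℕ} {ψ χ : FockN d N} (h : ∀ n : Mode d →₀ ℕ, n.degree = N → amp ψ n = amp χ n) :
    ψ = χ := by
  ext n
  rw [← amp_val, ← amp_val]
  exact h n.1 n.2

theorem amp_annih {N : ℕ} (k : Mode d) (ψ : FockN d N) (m : Mode d →₀ ℕ) :
    amp (annih N k ψ) m = (Real.sqrt ((m k : ℝ) + 1) : ℂ) * amp ψ (m + Finsupp.single k 1) := by
  by_cases h : m.degree = N - 1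
  · simp only [amp, h, dite_true]
    rfl
  · have h' : (m + Finsupp.single k 1).degree ≠ N := by
      rw [map_add, Finsupp.degree_single]; omega
    rw [amp_of_degree_ne _ h, amp_of_degree_ne _ h', mul_zero]

open Classical in
theorem amp_eq_inner {N : ℕ} (ψ : FockN d N) (n : Occ d N) :
    amp ψ n.1 = inner ℂ (lp.single 2 n (1 : ℂ) : FockN d N) ψ := by
  rw [lp.inner_single_left, amp_val]
  simp

open Classical in
theorem amp_single {N : ℕ} (n : Occ d N) (m : Mode d →₀ ℕ) :
    amp (lp.single 2 n (1 : ℂ) : FockN d N) m = if m = n.1 then 1 else 0 := by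
  by_cases h : m.degree = N
  · rw [show m = (⟨m, h⟩ : Occ d N).1 from rfl, amp_val, lp.single_apply]
    by_cases h2 : (⟨m, h⟩ : Occ d N) = n
    · subst h2; simp
    · have h3 : m ≠ n.1 := fun e => h2 (Subtype.ext e)
      simp [h2, h3]
  · have : m ≠ n.1 := by rintro rfl; exact h n.2
    rw [amp_of_degree_ne _ h, if_neg this]

/-- As `creat` is an adjoint, its coefficient at a configuration is the pairing with `annih` of that
basis vector. The case N = 0 must be excluded because there N - 1 truncates to 0. -/
theorem amp_creat_add {N : ℕ} (hN : 0 < N) (k : Mode d) (χ : FockN d (N - 1)) (m : Mode d →₀ ℕ) :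
    amp (creat N k χ) (m + Finsupp.single k 1) = (Real.sqrt ((m k : ℝ) + 1) : ℂ) * amp χ m := by
  classical
  by_cases h : m.degree = N - 1
  · have h' : (m + Finsupp.single k 1).degree = N := by
      rw [map_add, Finsupp.degree_single]; omega
    have key : annih N k (lp.single 2 (⟨_, h'⟩ : Occ d N) (1 : ℂ)) =
        (Real.sqrt ((m k : ℝ) + 1) : ℂ) •
          (lp.single 2 (⟨m, h⟩ : Occ d (N - 1)) (1 : ℂ) : FockN d (N - 1)) := by
      refine amp_ext fun n _ => ?_
      rw [amp_annih, amp_single, amp_smul, amp_single]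
      by_cases e : n = m
      · simp [e]
      · simp [e]
    have := amp_eq_inner (creat N k χ) ⟨_, h'⟩
    rw [this, creat, ContinuousLinearMap.adjoint_inner_right, key, inner_smul_left,
      ← amp_eq_inner χ ⟨m, h⟩]
    simp
  · have h' : (m + Finsupp.single k 1).degree ≠ N := by
      rw [map_add, Finsupp.degree_single]; omega
    rw [amp_of_degree_ne _ h, amp_of_degree_ne _ h', mul_zero]

theorem amp_creat_zero {N : ℕ} (k : Mode d) (χ : FockN d (N - 1)) {m : Mode d →₀ ℕ}
    (hm : m k = 0) : amp (creat N k χ) m = 0 := by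
  classical
  by_cases h : m.degree = N
  · have key : annih N k (lp.single 2 (⟨m, h⟩ : Occ d N) (1 : ℂ)) = 0 := by
      refine amp_ext fun n _ => ?_
      rw [amp_annih, amp_single, if_neg]
      · simp [amp]
      · intro e
        have := DFunLike.congr_fun e k
        simp [hm] at this
    have := amp_eq_inner (creat N k χ) ⟨m, h⟩
    rw [this, creat, ContinuousLinearMap.adjoint_inner_right, key, inner_zero_left]
  · exact amp_of_degree_ne _ h

theorem exists_eq_add_single {m : Mode d →₀ ℕ} {k : Mode d} {a : ℕ} (h : a ≤ m k) :
    ∃ m', m = m' + Finsupp.single k a :=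
  ⟨m - Finsupp.single k a, (tsub_add_cancel_of_le (Finsupp.single_le_iff.2 h)).symm⟩

theorem amp_num {N : ℕ} (hN : 0 < N) (k : Mode d) (ψ : FockN d N) (m : Mode d →₀ ℕ) :
    amp (num N k ψ) m = (m k : ℂ) * amp ψ m := by
  rcases Nat.eq_zero_or_pos (m k) with h | h
  · simp [num, amp_creat_zero k _ h, h]
  · obtain ⟨m, rfl⟩ := exists_eq_add_single (a := 1) h
    rw [num, ContinuousLinearMap.comp_apply, amp_creat_add hN, amp_annih, ← mul_assoc,
      ← Complex.ofReal_mul, Real.mul_self_sqrt (by positivity)]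
    simp

/-! ### Diagonal operators and their Neumann series -/

theorem sum_mul_sq_le {N : ℕ} (ψ : FockN d N) {g : Occ d N → ℝ} {C : ℝ} (hg : ∀ n, |g n| ≤ C)
    (s : Finset (Occ d N)) : ∑ n ∈ s, ‖(g n : ℂ) * ψ n‖ ^ 2 ≤ (C * ‖ψ‖) ^ 2 := by
  have hs : ∑ n ∈ s, ‖ψ n‖ ^ 2 ≤ ‖ψ‖ ^ 2 := by
    simpa using lp.sum_rpow_le_norm_rpow (p := 2) (by norm_num) ψ s
  calc ∑ n ∈ s, ‖(g n : ℂ) * ψ n‖ ^ 2 ≤ ∑ n ∈ s, C ^ 2 * ‖ψ n‖ ^ 2 := by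
        refine Finset.sum_le_sum fun n _ => ?_
        rw [norm_mul, mul_pow, Complex.norm_real, Real.norm_eq_abs]
        gcongr
        exact hg n
    _ = C ^ 2 * ∑ n ∈ s, ‖ψ n‖ ^ 2 := by rw [Finset.mul_sum]
    _ ≤ (C * ‖ψ‖) ^ 2 := by rw [mul_pow]; gcongr

theorem memlp_mul {N : ℕ} (ψ : FockN d N) {g : Occ d N → ℝ} {C : ℝ} (hg : ∀ n, |g n| ≤ C) :
    Memℓp (E := fun _ : Occ d N => ℂ) (fun n => (g n : ℂ) * ψ n) 2 :=
  memℓp_gen' (C := (C * ‖ψ‖) ^ 2) fun s => by simpa using sum_mul_sq_le ψ hg s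

/-- `T` acts diagonally on the occupation-number basis, with symbol `g`. -/
def IsDiag {N : ℕ} (T : FockN d N →L[ℂ] FockN d N) (g : (Mode d →₀ ℕ) → ℝ) : Prop :=
  ∀ ψ : FockN d N, ∀ n : Mode d →₀ ℕ, n.degree = N → amp (T ψ) n = (g n : ℂ) * amp ψ n

namespace IsDiag

variable {N : ℕ} {T U : FockN d N →L[ℂ] FockN d N} {g g' : (Mode d →₀ ℕ) → ℝ}

theorem congr (h : IsDiag T g) (e : ∀ n : Mode d →₀ ℕ, n.degree = N → g n = g' n) :
    IsDiag T g' := fun ψ n hn => by rw [h ψ n hn, e n hn]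

theorem mul (h : IsDiag T g) (h' : IsDiag U g') : IsDiag (T * U) fun n => g n * g' n := by
  intro ψ n hn
  rw [show (T * U) ψ = T (U ψ) from rfl, h _ n hn, h' _ n hn, Complex.ofReal_mul, mul_assoc]

theorem unique (h : IsDiag T g) (h' : IsDiag U g) : T = U := by
  ext1 ψ
  exact amp_ext fun n hn => by rw [h ψ n hn, h' ψ n hn]

theorem norm_le (h : IsDiag T g) {C : ℝ} (hC : 0 ≤ C)
    (hg : ∀ n : Mode d →₀ ℕ, n.degree = N → |g n| ≤ C) : ‖T‖ ≤ C := by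
  refine ContinuousLinearMap.opNorm_le_bound _ hC fun ψ => ?_
  refine lp.norm_le_of_forall_sum_le (p := 2) (by norm_num) (by positivity) fun s => ?_
  have hs := sum_mul_sq_le ψ (g := fun n => g n.1) (fun n => hg n.1 n.2) s
  have e : ∀ n : Occ d N, T ψ n = (g n.1 : ℂ) * ψ n := fun n => by
    rw [← amp_val, h ψ n.1 n.2, amp_val]
  simpa [e] using hs

theorem one_sub_mul_amp_tsum_pow (h : IsDiag T g) (hT : ‖T‖ < 1) (ψ : FockN d N)
    {n : Mode d →₀ ℕ} (hn : n.degree = N) :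
    (1 - (g n : ℂ)) * amp ((∑' l : ℕ, T ^ l) ψ) n = amp ψ n := by
  have h1 : amp (((1 - T) * ∑' l : ℕ, T ^ l) ψ) n = amp ψ n := by
    rw [mul_neg_geom_series T hT]; rfl
  have h2 : ((1 - T) * ∑' l : ℕ, T ^ l) ψ = (∑' l : ℕ, T ^ l) ψ - T ((∑' l : ℕ, T ^ l) ψ) := rfl
  rw [h2, amp_sub, h _ n hn] at h1
  rw [← h1]
  ring

theorem tsum_pow (h : IsDiag T g) (hT : ‖T‖ < 1) :
    IsDiag (∑' l : ℕ, T ^ l) fun n => (1 - g n)⁻¹ := by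
  classical
  intro ψ n hn
  -- If the symbol were 1 at n, then testing (1 - T) ∑ T^l = 1 on the basis vector at n would give 0
  -- = 1.
  have hne : (1 : ℂ) - (g n : ℂ) ≠ 0 := by
    intro h0
    have h1 := h.one_sub_mul_amp_tsum_pow hT (lp.single 2 (⟨n, hn⟩ : Occ d N) (1 : ℂ)) hn
    rw [h0, zero_mul, amp_single, if_pos rfl] at h1
    exact zero_ne_one h1
  push_cast
  rw [← h.one_sub_mul_amp_tsum_pow hT ψ hn]
  field_simp

end IsDiag

theorem exists_isDiag {N : ℕ} (g : (Mode d →₀ ℕ) → ℝ) {C : ℝ}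
    (hg : ∀ n : Mode d →₀ ℕ, n.degree = N → |g n| ≤ C) :
    ∃ T : FockN d N →L[ℂ] FockN d N, IsDiag T g := by
  have hg' : ∀ n : Occ d N, |g n.1| ≤ C := fun n => hg n.1 n.2
  by_cases hO : Nonempty (Occ d N)
  · have hC : 0 ≤ C := (abs_nonneg _).trans (hg' hO.some)
    refine ⟨LinearMap.mkContinuous
      { toFun := fun ψ => ⟨fun n => (g n.1 : ℂ) * ψ n, memlp_mul ψ hg'⟩
        map_add' := fun ψ χ => by ext n; exact mul_add _ (ψ n) (χ n)
        map_smul' := fun c ψ => by ext n; exact mul_left_comm _ c (ψ n) } C fun ψ => ?_,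
      fun ψ n hn => ?_⟩
    · refine lp.norm_le_of_forall_sum_le (p := 2) (by norm_num) (by positivity) fun s => ?_
      simpa using sum_mul_sq_le ψ hg' s
    · simp only [amp, hn, dite_true]
      rfl
  · exact ⟨0, fun ψ n hn => absurd ⟨⟨n, hn⟩⟩ hO⟩

/-! ### Scalar inequalities: super- and subsolutions of the recursion -/

/-- Replacing p by p - σ in the frozen solution p(1+ε+b) gains 2σb - σ²(1+ε-b) to leading order.
This is at least σb, exactly what is lost by moving z from E^Bog up to `zMax`. The terms of order
1/N are absorbed by the weight 1 - n/N, because p/N ≤ (1 - n/N)/2. -/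
theorem bogoliubov_supersolution {ε σ b N n p : ℝ} (hN : 0 < N) (hn : 0 ≤ n) (hp : 1 / 2 ≤ p)
    (hpn : 2 * p + n ≤ N) (hσ : 0 ≤ σ) (hσε : σ ^ 2 = ε) (hσ1 : σ ≤ 1 / 10) (hb : 0 ≤ b)
    (hb2 : b ^ 2 = ε ^ 2 + 2 * ε) :
    n / N * ((p + 1) ^ 2 * (1 + ε - b) / (p + 1 - σ)) + (n + 1) / N * ((p - σ) * (1 + ε + b)) ≤
      2 * p * (ε + n / N) + (1 + ε - b) - σ * b := by
  have hε : 0 ≤ ε := by rw [← hσε]; positivity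
  have hε1 : ε ≤ 1 / 100 := by rw [← hσε]; nlinarith
  have hbσ : σ ≤ b := by nlinarith
  have hb1 : b ≤ 15 / 100 := by nlinarith
  have hc0 : 0 ≤ 1 + ε - b := by linarith
  have hc1 : 1 + ε - b ≤ 1 := by nlinarith
  set ν := n / N with hν
  have hν0 : 0 ≤ ν := by positivity
  have hpν : p / N ≤ (1 - ν) / 2 := by
    rw [hν, div_le_iff₀ hN]
    field_simp
    linarith
  have hν1 : ν ≤ 1 := by
    have : 0 ≤ p / N := by positivity
    linarith
  have h1 : (p + 1) ^ 2 * (1 + ε - b) / (p + 1 - σ) ≤ (1 + ε - b) * (p + 1 + σ + σ ^ 2) := by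
    rw [div_le_iff₀ (by linarith)]
    have : (p + 1) ^ 2 ≤ (p + 1 + σ + σ ^ 2) * (p + 1 - σ) := by nlinarith [sq_nonneg σ]
    nlinarith
  have h2 : (p - σ) / N ≤ (1 - ν) / 2 := by
    refine le_trans ?_ hpν
    gcongr
    linarith
  have h3 : (n + 1) / N * ((p - σ) * (1 + ε + b)) =
      ν * ((p - σ) * (1 + ε + b)) + (p - σ) / N * (1 + ε + b) := by
    rw [hν]; field_simp
  have h4 : (p - σ) / N * (1 + ε + b) ≤ (1 - ν) / 2 * (1 + ε + b) := by gcongr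
  have h5 : ν * ((p + 1) ^ 2 * (1 + ε - b) / (p + 1 - σ)) ≤
      ν * ((1 + ε - b) * (p + 1 + σ + σ ^ 2)) := by gcongr
  have h6 : (1 - ν) * ((1 + ε + b) / 2) ≤ (1 - ν) * ((1 + ε - b) - σ * b) := by
    gcongr
    nlinarith
  -- The gain from the shift by σ: it suffices that (1+ε-b)σ ≤ b, which follows from σ ≤ b.
  have h7 : ν * ((1 + ε - b) + (1 + ε - b) * σ + (1 + ε - b) * σ ^ 2 - σ * (1 + ε + b)) ≤
      ν * ((1 + ε - b) - σ * b) := by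
    refine mul_le_mul_of_nonneg_left ?_ hν0
    have : (1 + ε - b) * σ ≤ b := by nlinarith
    nlinarith
  have h8 : 0 ≤ p * ε * (1 - ν) := mul_nonneg (by positivity) (by linarith)
  rw [h3]
  linarith [h4, h5, h6, h7, h8]

/-- The case σ = 0, at z = E^Bog itself. Nothing is lost in z, so p = 0 is allowed; there the bound
for the Schur entry becomes 0 ≤ f(E^Bog). -/
theorem bogoliubov_supersolution_even {ε b N n p : ℝ} (hN : 0 < N) (hn : 0 ≤ n) (hp : 0 ≤ p)
    (hpn : 2 * p + n ≤ N) (hε : 0 ≤ ε) (hε1 : ε ≤ 1 / 100) (hb : 0 ≤ b)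
    (hb2 : b ^ 2 = ε ^ 2 + 2 * ε) :
    n / N * ((p + 1) * (1 + ε - b)) + (n + 1) / N * (p * (1 + ε + b)) ≤
      2 * p * (ε + n / N) + (1 + ε - b) := by
  have hb1 : b ≤ 15 / 100 := by nlinarith
  set ν := n / N with hν
  have hν0 : 0 ≤ ν := by positivity
  have hpν : p / N ≤ (1 - ν) / 2 := by
    rw [hν, div_le_iff₀ hN]
    field_simp
    linarith
  have hν1 : ν ≤ 1 := by
    have : 0 ≤ p / N := by positivity
    linarith
  have h3 : (n + 1) / N * (p * (1 + ε + b)) =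
      ν * (p * (1 + ε + b)) + p / N * (1 + ε + b) := by
    rw [hν]; field_simp
  have h4 : p / N * (1 + ε + b) ≤ (1 - ν) / 2 * (1 + ε + b) := by gcongr
  have h6 : (1 - ν) * ((1 + ε + b) / 2) ≤ (1 - ν) * (1 + ε - b) := by
    gcongr
    linarith
  have h8 : 0 ≤ p * ε * (1 - ν) := mul_nonneg (by positivity) (by linarith)
  rw [h3]
  linarith

/-- The candidate upper bound is the frozen solution times 1 + 3/(Nb). Of this extra factor, the
part proportional to p contributes 2p·3/N = 6p/N, and the term 3/(Nb)·(1+ε-b) in the energy shift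
cancels the remaining part. With the shift 2/N, the total surplus is (1-c)(4p²+6p+2)/N ≥ 0, where c
= 1+ε-b. -/
theorem bogoliubov_subsolution {ε b N p : ℝ} {t : ℕ} (hN : 0 < N) (hp : 0 ≤ p)
    (hpn : 2 * p + t = N) (hb : 0 < b) (hε : 0 ≤ ε) (hb2 : b ^ 2 = ε ^ 2 + 2 * ε) :
    2 * p * (ε + t / N) + (1 + ε - b) - (2 / N + 3 / (N * b) * (1 + ε - b)) ≤
      (1 + 3 / (N * b)) * (p * (1 + ε + b)) + ((p + 1) ^ 2 * (t * (t - 1)) / N ^ 2) /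
        ((1 + 3 / (N * b)) * ((p + 1) * (1 + ε + b))) := by
  have hce : (1 + ε - b) * (1 + ε + b) = 1 := by nlinarith
  have hc0 : 0 < 1 + ε - b := by nlinarith
  have hc1 : 1 + ε - b ≤ 1 := by nlinarith
  set c := 1 + ε - b with hc
  set k := (1 + 3 / (N * b)) * ((p + 1) * (1 + ε + b)) with hk
  set w := (p + 1) * (t - 1) / N with hw
  have hk0 : 0 < k := by positivity
  -- The quotient w²/k is bounded below by its tangent at w = kc, so that only linear terms in t
  -- remain. For t ≥ 1 the product t(t-1) dominates (t-1)²; for t = 0 the left side is negative.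
  have hwk : 2 * w * c - k * c ^ 2 ≤ ((p + 1) ^ 2 * (t * (t - 1)) / N ^ 2) / k := by
    rcases Nat.eq_zero_or_pos t with h | h
    · have h1 : w * c ≤ 0 := by
        rw [hw, h]
        apply mul_nonpos_of_nonpos_of_nonneg _ hc0.le
        apply div_nonpos_of_nonpos_of_nonneg _ hN.le
        push_cast
        linarith
      have h2 : 0 < k * c ^ 2 := by positivity
      rw [h]
      simp only [Nat.cast_zero, zero_mul, mul_zero, zero_div]
      linarith
    · have h1 : (1 : ℝ) ≤ t := by exact_mod_cast h
      have h2 : w ^ 2 ≤ (p + 1) ^ 2 * (t * (t - 1)) / N ^ 2 := by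
        rw [hw, div_pow, mul_pow]
        gcongr
        nlinarith
      calc 2 * w * c - k * c ^ 2 ≤ w ^ 2 / k := by
            rw [le_div_iff₀ hk0]
            nlinarith [sq_nonneg (w - k * c)]
        _ ≤ _ := by gcongr
  have hkc : k * c ^ 2 = (1 + 3 / (N * b)) * ((p + 1) * c) := by
    rw [hk]
    linear_combination (1 + 3 / (N * b)) * (p + 1) * c * hce
  refine le_trans ?_ (add_le_add_right hwk _)
  rw [hkc, hw]
  have ht : (t : ℝ) = N - 2 * p := by linarith
  have h9 : 0 ≤ (1 - c) * (4 * p ^ 2) := by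
    have : 0 ≤ 1 - c := by linarith
    positivity
  have e1 : 1 + ε + b = c + 2 * b := by rw [hc]; ring
  have e2 : ε = c + b - 1 := by rw [hc]; ring
  rw [ht, e1, e2]
  rw [← sub_nonneg]
  have : ((1 + 3 / (N * b)) * (p * (c + 2 * b)) + (2 * ((p + 1) * (N - 2 * p - 1) / N) * c -
      (1 + 3 / (N * b)) * ((p + 1) * c)) - (2 * p * (c + b - 1 + (N - 2 * p) / N) + c -
      (2 / N + 3 / (N * b) * c))) = ((1 - c) * (4 * p ^ 2) + (1 - c) * (6 * p + 2)) / N := by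
    field_simp
    ring
  rw [this]
  have : 0 ≤ (1 - c) * (6 * p + 2) := mul_nonneg (by linarith) (by positivity)
  positivity

end BogoliubovThreeModes

namespace ThreeModeSystem

open BogoliubovThreeModes

variable {d : ℕ} (S : ThreeModeSystem d)

/-! ### Matrix elements of the Hamiltonian -/

theorem N_cast_pos : (0 : ℝ) < S.N := by exact_mod_cast S.N_pos

theorem two_le_N : 2 ≤ S.N := by
  have := S.N_pos
  obtain ⟨k, hk⟩ := S.N_even
  omega

theorem j_ne_neg : S.j ≠ -S.j := by
  intro h
  apply S.j_ne
  funext i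
  have := congrFun h i
  simp only [Pi.neg_apply] at this
  simp only [Pi.zero_apply]
  omega

/-- The matrix element of `W` between the configurations `m` plus a pair in the modes `±j` and `m`
plus two particles in the zero mode. -/
noncomputable def coupling (m : Mode d →₀ ℕ) : ℝ :=
  S.φ / S.N * (Real.sqrt (m 0 + 1) * Real.sqrt (m 0 + 2) *
    Real.sqrt (m S.j + 1) * Real.sqrt (m (-S.j) + 1))

theorem amp_W_add (ψ : S.Space) (m : Mode d →₀ ℕ) :
    amp (S.W ψ) (m + Finsupp.single 0 2) =
      S.coupling m * amp ψ (m + Finsupp.single S.j 1 + Finsupp.single (-S.j) 1) := by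
  have hN := S.two_le_N
  have e : m + Finsupp.single 0 2 = m + Finsupp.single 0 1 + Finsupp.single 0 1 := by
    rw [add_assoc, ← Finsupp.single_add]
  have h1 : (Finsupp.single S.j 1 : Mode d →₀ ℕ) (-S.j) = 0 := by
    simp [S.j_ne_neg]
  simp only [W, smul_apply, ContinuousLinearMap.comp_apply, amp_smul]
  rw [e, amp_creat_add (by omega), amp_creat_add (by omega), amp_annih, amp_annih]
  simp only [Finsupp.add_apply, Finsupp.single_eq_same, h1, add_zero, coupling]
  push_cast
  rw [add_assoc (m 0 : ℝ) 1 1, one_add_one_eq_two]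
  ring

theorem amp_W_zero (ψ : S.Space) {n : Mode d →₀ ℕ} (hn : n 0 < 2) : amp (S.W ψ) n = 0 := by
  have hN := S.two_le_N
  simp only [W, smul_apply, ContinuousLinearMap.comp_apply, amp_smul]
  rcases Nat.eq_zero_or_pos (n 0) with h | h
  · rw [amp_creat_zero _ _ h, mul_zero]
  · obtain ⟨m, rfl⟩ := exists_eq_add_single (a := 1) h
    have hm : m 0 = 0 := by simpa using hn
    rw [amp_creat_add (by omega), amp_creat_zero _ _ hm, mul_zero, mul_zero]

theorem amp_Wstar_add (ψ : S.Space) (m : Mode d →₀ ℕ) :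
    amp (S.Wstar ψ) (m + Finsupp.single S.j 1 + Finsupp.single (-S.j) 1) =
      S.coupling m * amp ψ (m + Finsupp.single 0 2) := by
  have hN := S.two_le_N
  have e : m + Finsupp.single 0 2 = m + Finsupp.single 0 1 + Finsupp.single 0 1 := by
    rw [add_assoc, ← Finsupp.single_add]
  have h1 : (Finsupp.single (-S.j) 1 : Mode d →₀ ℕ) S.j = 0 := by
    simp [S.j_ne_neg.symm]
  simp only [Wstar, smul_apply, ContinuousLinearMap.comp_apply, amp_smul]
  rw [add_right_comm, amp_creat_add (by omega), amp_creat_add (by omega), amp_annih, amp_annih, e]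
  simp only [Finsupp.add_apply, Finsupp.single_eq_same, h1, add_zero, coupling]
  push_cast
  rw [add_assoc (m 0 : ℝ) 1 1, one_add_one_eq_two]
  ring

theorem amp_Wstar_zero (ψ : S.Space) {n : Mode d →₀ ℕ} (hn : n S.j = 0 ∨ n (-S.j) = 0) :
    amp (S.Wstar ψ) n = 0 := by
  have hN := S.two_le_N
  simp only [Wstar, smul_apply, ContinuousLinearMap.comp_apply, amp_smul]
  rcases Nat.eq_zero_or_pos (n S.j) with h | h
  · rw [amp_creat_zero _ _ h, mul_zero]
  · have h2 : n (-S.j) = 0 := by omega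
    obtain ⟨m, rfl⟩ := exists_eq_add_single (a := 1) h
    have hm : m (-S.j) = 0 := by
      rw [Finsupp.add_apply] at h2
      omega
    rw [amp_creat_add (by omega), amp_creat_zero _ _ hm, mul_zero, mul_zero]

/-- The kinetic energy of the modes other than `±j`, for a configuration of any particle number. -/
noncomputable def restEnergy (n : Mode d →₀ ℕ) : ℝ :=
  ∑ k ∈ n.support \ {S.j, -S.j}, S.kin k * (n k : ℝ)

theorem kin_nonneg (k : Mode d) : 0 ≤ S.kin k := Finset.sum_nonneg fun _ _ => sq_nonneg _

theorem restEnergy_nonneg (n : Mode d →₀ ℕ) : 0 ≤ S.restEnergy n :=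
  Finset.sum_nonneg fun k _ => mul_nonneg (S.kin_nonneg k) (Nat.cast_nonneg _)

/-- The number of particles in the modes `±j`. -/
def pairs (n : Mode d →₀ ℕ) : ℕ := n S.j + n (-S.j)

/-- The diagonal matrix element of `H - z` at the configuration `n`. -/
noncomputable def diagEnergy (z : ℝ) (n : Mode d →₀ ℕ) : ℝ :=
  S.restEnergy n + (S.kin S.j + S.φ / S.N * n 0) * S.pairs n - z

theorem diagEnergy_ge (z : ℝ) (n : Mode d →₀ ℕ) : S.restEnergy n - z ≤ S.diagEnergy z n := by
  have h1 := S.kin_nonneg S.j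
  have h2 := S.φ_pos
  have h3 := S.N_cast_pos
  have : 0 ≤ (S.kin S.j + S.φ / S.N * n 0) * S.pairs n := by positivity
  unfold diagEnergy
  linarith

theorem neg_le_diagEnergy (z : ℝ) (n : Mode d →₀ ℕ) : -z ≤ S.diagEnergy z n := by
  linarith [S.diagEnergy_ge z n, S.restEnergy_nonneg n]

theorem isDiag_H0hat : IsDiag S.H0hat fun n => (S.kin S.j + S.φ / S.N * n 0) * S.pairs n := by
  intro ψ n hn
  simp only [H0hat, ContinuousLinearMap.comp_apply, add_apply,
    smul_apply, ContinuousLinearMap.id_apply, amp_add, amp_smul,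
    amp_num S.N_pos, pairs]
  push_cast
  ring

theorem amp_HBog (ψ : S.HBog.domain) {n : Mode d →₀ ℕ} (hn : n.degree = S.N) (z : ℝ) :
    amp (S.HBog ψ - (z : ℂ) • (ψ : S.Space)) n =
      (S.diagEnergy z n : ℂ) * amp (ψ : S.Space) n +
        (amp (S.W (ψ : S.Space)) n + amp (S.Wstar (ψ : S.Space)) n) := by
  have e : S.HBog ψ = S.kineticRest.toFun ψ + (S.H0hat ψ + S.W ψ + S.Wstar ψ) := rfl
  have e2 : amp (S.kineticRest.toFun ψ) n = (S.restEnergy n : ℂ) * amp (ψ : S.Space) n := by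
    simp only [amp, hn, dite_true]
    rfl
  rw [amp_sub, amp_smul, e, amp_add, amp_add, amp_add, e2, S.isDiag_H0hat _ n hn, diagEnergy]
  push_cast
  ring

/-! ### Sectors and the vanishing of W inside a sector -/

/-- The configurations with `N - i` or `N - i - 1` particles in the modes `±j`. -/
def InSector (i : ℕ) (n : Mode d →₀ ℕ) : Prop :=
  S.pairs n + i = S.N ∨ S.pairs n + i + 1 = S.N

open Classical in
/-- The characteristic function of a sector. -/
noncomputable def sectorInd (i : ℕ) (n : Mode d →₀ ℕ) : ℝ := if S.InSector i n then 1 else 0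

theorem mem_sector_iff {i : ℕ} {ψ : S.Space} :
    ψ ∈ S.sector i ↔ ∀ n : Mode d →₀ ℕ, n.degree = S.N → ¬ S.InSector i n → amp ψ n = 0 := by
  constructor
  · intro h n hn hs
    simp only [InSector, pairs, not_or] at hs
    rw [show n = (⟨n, hn⟩ : Occ d S.N).1 from rfl, amp_val]
    exact h ⟨n, hn⟩ hs.1 hs.2
  · intro h n h1 h2
    rw [← amp_val]
    exact h n.1 n.2 (by simp only [InSector, pairs, not_or]; exact ⟨h1, h2⟩)

theorem isDiag_Q (i : ℕ) : IsDiag (S.Q i) (S.sectorInd i) := by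
  classical
  obtain ⟨T, hT⟩ := exists_isDiag (N := S.N) (S.sectorInd i) (C := 1) fun n _ => by
    unfold sectorInd; split_ifs <;> simp
  suffices S.Q i = T by rwa [this]
  ext1 ψ
  refine (Submodule.eq_starProjection_of_mem_of_inner_eq_zero ?_ fun χ hχ => ?_)
  · rw [mem_sector_iff]
    intro n hn hs
    rw [hT _ n hn, sectorInd, if_neg hs]
    simp
  · rw [lp.inner_eq_tsum]
    refine (tsum_congr fun n => ?_).trans tsum_zero
    rw [← amp_val, ← amp_val, amp_sub, hT _ _ n.2]
    by_cases hs : S.InSector i n.1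
    · simp [sectorInd, hs]
    · rw [S.mem_sector_iff.1 hχ n.1 n.2 hs]
      simp

theorem sectorInd_cases {i : ℕ} (n : Mode d →₀ ℕ) :
    (S.InSector i n ∧ S.sectorInd i n = 1) ∨ (¬ S.InSector i n ∧ S.sectorInd i n = 0) := by
  classical
  by_cases h : S.InSector i n
  · exact Or.inl ⟨h, by simp [sectorInd, h]⟩
  · exact Or.inr ⟨h, by simp [sectorInd, h]⟩

theorem pairs_add_single_zero (m : Mode d →₀ ℕ) (a : ℕ) :
    S.pairs (m + Finsupp.single 0 a) = S.pairs m := by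
  simp [pairs, S.j_ne]

theorem pairs_add_pair (m : Mode d →₀ ℕ) :
    S.pairs (m + Finsupp.single S.j 1 + Finsupp.single (-S.j) 1) = S.pairs m + 2 := by
  simp only [pairs, Finsupp.add_apply, Finsupp.single_apply, S.j_ne_neg, S.j_ne_neg.symm]
  simp
  omega

/-- The two pair counts of a sector differ by one, whereas `W` changes the count by two. -/
theorem amp_W_eq_zero {i : ℕ} {ψ : S.Space} (hψ : ψ ∈ S.sector i) {n : Mode d →₀ ℕ}
    (hn : n.degree = S.N) (hs : S.InSector i n) : amp (S.W ψ) n = 0 := by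
  rcases lt_or_ge (n 0) 2 with h | h
  · exact S.amp_W_zero ψ h
  · obtain ⟨m, rfl⟩ := exists_eq_add_single h
    rw [amp_W_add, S.mem_sector_iff.1 hψ, mul_zero]
    · simp only [map_add, Finsupp.degree_single] at hn ⊢; omega
    · simp only [InSector, pairs_add_pair, pairs_add_single_zero] at hs ⊢; omega

theorem amp_Wstar_eq_zero {i : ℕ} {ψ : S.Space} (hψ : ψ ∈ S.sector i) {n : Mode d →₀ ℕ}
    (hn : n.degree = S.N) (hs : S.InSector i n) : amp (S.Wstar ψ) n = 0 := by
  by_cases h : n S.j = 0 ∨ n (-S.j) = 0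
  · exact S.amp_Wstar_zero ψ h
  · obtain ⟨m, rfl⟩ := exists_eq_add_single (m := n) (k := -S.j) (a := 1) (by omega)
    obtain ⟨m, rfl⟩ := exists_eq_add_single (m := m) (k := S.j) (a := 1) (by
      simp [S.j_ne_neg.symm] at h; omega)
    rw [amp_Wstar_add, S.mem_sector_iff.1 hψ, mul_zero]
    · simp only [map_add, Finsupp.degree_single] at hn ⊢; omega
    · simp only [InSector, pairs_add_pair, pairs_add_single_zero] at hs ⊢; omega

/-! ### The compressed resolvents -/

/-- The operator `R` is obtained by choice, so the formula has to be proved for every compressed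
resolvent. Since z < 0, the diagonal entries are at least -z > 0. -/
theorem isDiag_of_isCompressedResolvent {i : ℕ} {z : ℝ} (hz : z < 0) {T : S.Space →L[ℂ] S.Space}
    (hT : IsCompressedResolvent S.HBog (S.Q i) z T) :
    IsDiag T fun n => S.sectorInd i n / S.diagEnergy z n := by
  intro ψ n hn
  have hmem : T ψ ∈ S.sector i := by
    have : T ψ = S.Q i (T ψ) := (DFunLike.congr_fun hT.1 ψ).symm
    rw [this]
    exact Submodule.starProjection_apply_mem _ _
  rcases S.sectorInd_cases (i := i) n with ⟨hs, h1⟩ | ⟨hs, h1⟩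
  · obtain ⟨hd, h2⟩ := hT.2.2.1 ψ
    have h3 := congrArg (fun χ => amp χ n) h2
    simp only [S.isDiag_Q i _ n hn, h1, S.amp_HBog ⟨T ψ, hd⟩ hn, S.amp_W_eq_zero hmem hn hs,
      S.amp_Wstar_eq_zero hmem hn hs] at h3
    have hD : (S.diagEnergy z n : ℂ) ≠ 0 := by
      have := S.neg_le_diagEnergy z n
      exact_mod_cast (by linarith : 0 < S.diagEnergy z n).ne'
    simp only [h1]
    push_cast at h3 ⊢
    field_simp
    linear_combination h3
  · simp [S.mem_sector_iff.1 hmem n hn hs, h1]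

theorem exists_isCompressedResolvent (i : ℕ) {z : ℝ} (hz : z < 0) :
    ∃ T, IsCompressedResolvent S.HBog (S.Q i) z T := by
  have hpos : ∀ n, 0 < S.diagEnergy z n := fun n => by linarith [S.neg_le_diagEnergy z n]
  obtain ⟨T, hT⟩ := exists_isDiag (N := S.N) (fun n => S.sectorInd i n / S.diagEnergy z n)
    (C := (-z)⁻¹) fun n _ => by
      have h1 := S.neg_le_diagEnergy z n
      rw [abs_of_nonneg, div_eq_mul_inv]
      · have h2 : S.sectorInd i n ≤ 1 := by unfold sectorInd; split_ifs <;> simp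
        calc _ ≤ 1 * (S.diagEnergy z n)⁻¹ :=
              mul_le_mul_of_nonneg_right h2 (inv_nonneg.2 (hpos n).le)
          _ ≤ _ := by rw [one_mul]; exact inv_anti₀ (by linarith) h1
      · refine div_nonneg ?_ (hpos n).le
        unfold sectorInd; split_ifs <;> simp
  have hmem : ∀ ψ, T ψ ∈ S.sector i := fun ψ => by
    rw [mem_sector_iff]
    intro n hn hs
    rcases S.sectorInd_cases (i := i) n with ⟨h, _⟩ | ⟨_, h1⟩
    · exact absurd h hs
    · simp [hT _ n hn, h1]
  -- The kinetic energy of the other modes is unbounded, but for z < 0 it is dominated by the full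
  -- diagonal entry, so its product with the resolvent symbol is at most 1.
  have hdom : ∀ ψ, T ψ ∈ S.HBog.domain := by
    intro ψ
    have h := memlp_mul (N := S.N) ψ
      (g := fun n => S.restEnergy n.1 * (S.sectorInd i n.1 / S.diagEnergy z n.1)) (C := 1)
      (fun n => by
        have h1 := S.diagEnergy_ge z n.1
        have h2 := S.restEnergy_nonneg n.1
        have h3 := hpos n.1
        rcases S.sectorInd_cases (i := i) n.1 with ⟨_, h⟩ | ⟨_, h⟩
        · rw [h, ← mul_div_assoc, mul_one, abs_of_nonneg (by positivity), div_le_one h3]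
          linarith
        · simp [h])
    change Memℓp (E := fun _ : Occ d S.N => ℂ) (fun n => (S.kinRest n : ℂ) * T ψ n) 2
    convert h using 2 with n
    rw [← amp_val, hT ψ n.1 n.2, amp_val]
    change (S.restEnergy n.1 : ℂ) * _ = _
    push_cast
    ring
  refine ⟨T, ?_, ?_, fun ψ => ⟨hdom ψ, ?_⟩, fun ψ hψ => ?_⟩
  · exact ((S.isDiag_Q i).mul hT).unique (hT.congr fun n _ => by
      rcases S.sectorInd_cases (i := i) n with ⟨_, h⟩ | ⟨_, h⟩ <;> simp [h])
  · exact (hT.mul (S.isDiag_Q i)).unique (hT.congr fun n _ => by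
      rcases S.sectorInd_cases (i := i) n with ⟨_, h⟩ | ⟨_, h⟩ <;> simp [h])
  · refine amp_ext fun n hn => ?_
    rw [S.isDiag_Q i _ n hn, S.isDiag_Q i _ n hn, S.amp_HBog ⟨T ψ, hdom ψ⟩ hn]
    rcases S.sectorInd_cases (i := i) n with ⟨hs, h⟩ | ⟨_, h⟩
    · have hD : (S.diagEnergy z n : ℂ) ≠ 0 := by exact_mod_cast (hpos n).ne'
      simp only [S.amp_W_eq_zero (hmem ψ) hn hs, S.amp_Wstar_eq_zero (hmem ψ) hn hs, hT ψ n hn, h]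
      push_cast
      field_simp
      simp
    · simp [h]
  · have hψm : (ψ : S.Space) ∈ S.sector i := by
      rw [← hψ]; exact Submodule.starProjection_apply_mem _ _
    refine amp_ext fun n hn => ?_
    rw [hT _ n hn, S.isDiag_Q i _ n hn, S.amp_HBog ψ hn]
    rcases S.sectorInd_cases (i := i) n with ⟨hs, h⟩ | ⟨hs, h⟩
    · have hD : (S.diagEnergy z n : ℂ) ≠ 0 := by exact_mod_cast (hpos n).ne'
      simp only [S.amp_W_eq_zero hψm hn hs, S.amp_Wstar_eq_zero hψm hn hs, h]
      push_cast
      field_simp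
      simp
    · rw [h, S.mem_sector_iff.1 hψm n hn hs]
      simp

theorem isDiag_R (i : ℕ) {z : ℝ} (hz : z < 0) :
    IsDiag (S.R i z) fun n => S.sectorInd i n / S.diagEnergy z n := by
  have h := S.exists_isCompressedResolvent i hz
  rw [R, compressedResolvent, dif_pos h]
  exact S.isDiag_of_isCompressedResolvent hz h.choose_spec

/-! ### Dimensionless parameters -/

/-- The Bogoliubov excitation energy in units of `φ`. -/
noncomputable def gap : ℝ := Real.sqrt (S.eps ^ 2 + 2 * S.eps)

theorem kin_pos {k : Mode d} (hk : k ≠ 0) : 0 < S.kin k := by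
  obtain ⟨i, hi⟩ := Function.ne_iff.1 hk
  refine Finset.sum_pos' (fun _ _ => sq_nonneg _) ⟨i, Finset.mem_univ _, ?_⟩
  have h1 : (k i : ℝ) ≠ 0 := by exact_mod_cast hi
  have h2 := S.L_pos
  positivity

theorem eps_pos : 0 < S.eps := div_pos (S.kin_pos S.j_ne) S.φ_pos

theorem kin_eq : S.kin S.j = S.φ * S.eps := by
  rw [eps, mul_div_cancel₀ _ S.φ_pos.ne']

theorem gap_sq : S.gap ^ 2 = S.eps ^ 2 + 2 * S.eps :=
  Real.sq_sqrt (by have := S.eps_pos; positivity)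

theorem gap_pos : 0 < S.gap := Real.sqrt_pos.2 (by have := S.eps_pos; positivity)

theorem EBog_eq : S.EBog = -(S.φ * (1 + S.eps - S.gap)) := by
  have h : S.kin S.j ^ 2 + 2 * S.φ * S.kin S.j = S.φ ^ 2 * (S.eps ^ 2 + 2 * S.eps) := by
    rw [kin_eq]; ring
  rw [EBog, h, Real.sqrt_mul (sq_nonneg _), Real.sqrt_sq S.φ_pos.le, kin_eq, gap]
  ring

theorem zMax_eq : S.zMax = -(S.φ * (1 + S.eps - S.gap - Real.sqrt S.eps * S.gap)) := by
  rw [zMax, EBog_eq, ← gap]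
  ring

theorem sqrt_eps_le_gap : Real.sqrt S.eps ≤ S.gap := by
  have := S.eps_pos
  exact Real.sqrt_le_sqrt (by nlinarith)

theorem sqrt_eps_le {S : ThreeModeSystem d} (hε : S.eps ≤ 1 / 100) : Real.sqrt S.eps ≤ 1 / 10 := by
  rw [Real.sqrt_le_left (by norm_num)]
  linarith

theorem gap_le {S : ThreeModeSystem d} (hε : S.eps ≤ 1 / 100) : S.gap ≤ 15 / 100 := by
  have := S.eps_pos
  rw [gap, Real.sqrt_le_left (by norm_num)]
  nlinarith

theorem EBog_le_zMax : S.EBog ≤ S.zMax := by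
  have h1 := S.φ_pos
  have h2 := S.gap_pos
  rw [zMax, ← gap]
  have : 0 ≤ Real.sqrt S.eps * S.φ * S.gap := by positivity
  linarith

theorem zMax_neg {S : ThreeModeSystem d} (hε : S.eps ≤ 1 / 100) : S.zMax < 0 := by
  have h1 := gap_le hε
  have h2 := sqrt_eps_le hε
  have h3 := S.eps_pos
  have h4 := S.gap_pos
  have : 0 < 1 + S.eps - S.gap - Real.sqrt S.eps * S.gap := by nlinarith
  have := mul_pos S.φ_pos this
  rw [zMax_eq]
  linarith

/-! ### The Schur recursion and its lower bound -/

/-- The configuration obtained from `n` by moving two particles from the zero mode into the modes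
`±j`. -/
noncomputable def pairUp (n : Mode d →₀ ℕ) : Mode d →₀ ℕ :=
  n - Finsupp.single 0 2 + Finsupp.single S.j 1 + Finsupp.single (-S.j) 1

/-- The squared matrix element of `W` between `pairUp n` and `n`. -/
noncomputable def couplingSq (n : Mode d →₀ ℕ) : ℝ :=
  (S.φ / S.N) ^ 2 * ((n 0 : ℝ) * (n 0 - 1)) * ((n S.j + 1) * (n (-S.j) + 1))

theorem couplingSq_nonneg (n : Mode d →₀ ℕ) : 0 ≤ S.couplingSq n := by
  have h : (0 : ℝ) ≤ (n 0 : ℝ) * (n 0 - 1) := by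
    rcases Nat.eq_zero_or_pos (n 0) with h | h
    · simp [h]
    · have : (1 : ℝ) ≤ n 0 := by exact_mod_cast h
      exact mul_nonneg (by linarith) (by linarith)
  unfold couplingSq
  positivity

/-- This makes the truncated subtraction in `pairUp` harmless: with fewer than two particles in the
zero mode, the value there is multiplied by zero. -/
theorem couplingSq_eq_zero {n : Mode d →₀ ℕ} (h : n 0 < 2) : S.couplingSq n = 0 := by
  have : n 0 = 0 ∨ n 0 = 1 := by omega
  rcases this with h | h <;> simp [couplingSq, h]

theorem coupling_mul_self (m : Mode d →₀ ℕ) :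
    S.coupling m * S.coupling m = S.couplingSq (m + Finsupp.single 0 2) := by
  have h1 : (m + Finsupp.single 0 2 : Mode d →₀ ℕ) S.j = m S.j := by simp [S.j_ne]
  have h2 : (m + Finsupp.single 0 2 : Mode d →₀ ℕ) (-S.j) = m (-S.j) := by simp [S.j_ne]
  have h3 : (m + Finsupp.single 0 2 : Mode d →₀ ℕ) 0 = m 0 + 2 := by simp
  have r : ∀ x : ℝ, 0 ≤ x → Real.sqrt x ^ 2 = x := fun x hx => Real.sq_sqrt hx
  rw [couplingSq, h1, h2, h3, coupling, ← pow_two]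
  simp only [mul_pow]
  rw [r _ (by positivity), r _ (by positivity), r _ (by positivity), r _ (by positivity)]
  push_cast
  ring

theorem pairUp_add (m : Mode d →₀ ℕ) :
    S.pairUp (m + Finsupp.single 0 2) = m + Finsupp.single S.j 1 + Finsupp.single (-S.j) 1 := by
  rw [pairUp, add_tsub_cancel_right]

theorem degree_pairUp {n : Mode d →₀ ℕ} (h : 2 ≤ n 0) : (S.pairUp n).degree = n.degree := by
  obtain ⟨m, rfl⟩ := exists_eq_add_single h
  simp only [pairUp_add, map_add, Finsupp.degree_single]

theorem pairs_pairUp {n : Mode d →₀ ℕ} (h : 2 ≤ n 0) : S.pairs (S.pairUp n) = S.pairs n + 2 := by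
  obtain ⟨m, rfl⟩ := exists_eq_add_single h
  rw [pairUp_add, pairs_add_pair, pairs_add_single_zero]

theorem pairUp_zero {n : Mode d →₀ ℕ} (h : 2 ≤ n 0) : (S.pairUp n) 0 = n 0 - 2 := by
  obtain ⟨m, rfl⟩ := exists_eq_add_single h
  simp [pairUp_add, S.j_ne]

/-- The diagonal entry at `n` of the Schur complement reached after eliminating `k` sectors. -/
noncomputable def schur (z : ℝ) : ℕ → (Mode d →₀ ℕ) → ℝ
  | 0, n => S.diagEnergy z n
  | k + 1, n => S.diagEnergy z n - S.couplingSq n / schur z k (S.pairUp n)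

theorem pairs_add_le_degree (n : Mode d →₀ ℕ) : S.pairs n + n 0 ≤ n.degree := by
  obtain ⟨m, hm⟩ := exists_eq_add_single (le_refl (n 0))
  have h1 : m S.j = n S.j := by rw [hm]; simp [S.j_ne]
  obtain ⟨m', hm'⟩ := exists_eq_add_single (le_refl (m S.j))
  have h2 : m' (-S.j) = n (-S.j) := by
    have : m' (-S.j) = m (-S.j) := by rw [hm']; simp [S.j_ne_neg]
    rw [this, hm]; simp [S.j_ne]
  have h3 : n.degree = m'.degree + m S.j + n 0 := by
    conv_lhs => rw [hm, hm']
    simp only [map_add, Finsupp.degree_single]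
  have h4 : m' (-S.j) ≤ m'.degree := Finsupp.le_degree _ _
  rw [pairs]
  omega

/-- A lower bound for the entries of all Schur complements below `zMax`. -/
noncomputable def schurLow (n : Mode d →₀ ℕ) : ℝ :=
  S.φ * ((n 0 + 1) / S.N * ((S.pairs n / 2 - Real.sqrt S.eps) * (1 + S.eps + S.gap)))

variable {S} in
theorem schurLow_ge (hε : S.eps ≤ 1 / 100) {n : Mode d →₀ ℕ} (hp : 1 ≤ S.pairs n) :
    S.φ / S.N * (2 / 5) ≤ S.schurLow n := by
  have h1 := S.φ_pos
  have h2 := S.N_cast_pos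
  have h3 := sqrt_eps_le hε
  have h4 := S.gap_pos
  have h5 := S.eps_pos
  have hp' : (1 : ℝ) ≤ S.pairs n := by exact_mod_cast hp
  -- With at least one particle in the modes ±j, the first factor is at least 1/2 - 1/10, and the
  -- second is at least 1.
  have h6 : (2 / 5 : ℝ) ≤ (S.pairs n / 2 - Real.sqrt S.eps) * (1 + S.eps + S.gap) := by nlinarith
  have h7 : (1 : ℝ) ≤ n 0 + 1 := by simp
  calc S.φ / S.N * (2 / 5) = S.φ * (1 / S.N * (2 / 5)) := by ring
    _ ≤ S.schurLow n := by
      unfold schurLow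
      gcongr

variable {S} in
theorem schurLow_pos (hε : S.eps ≤ 1 / 100) {n : Mode d →₀ ℕ} (hp : 1 ≤ S.pairs n) :
    0 < S.schurLow n := by
  have h1 := S.φ_pos
  have h2 := S.N_cast_pos
  exact lt_of_lt_of_le (by positivity) (schurLow_ge hε hp)

theorem inv_eq_gap : (1 + S.eps - S.gap) * (1 + S.eps + S.gap) = 1 := by
  linear_combination -S.gap_sq

-- `schurLow` is a supersolution of the recursion below `zMax`, even with the kinetic energy of the
-- other modes dropped. Here p is half the number of particles in the modes ±j, possibly a
-- half-integer.
variable {S} in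
theorem schurLow_step (hε : S.eps ≤ 1 / 100) {z : ℝ} (hz : z ≤ S.zMax) {n : Mode d →₀ ℕ}
    (hn : n.degree = S.N) (hp : 1 ≤ S.pairs n) :
    S.couplingSq n / S.schurLow (S.pairUp n) + S.schurLow n ≤
      S.diagEnergy z n - S.restEnergy n := by
  have h1 := S.φ_pos
  have h2 := S.N_cast_pos
  have h3 := sqrt_eps_le hε
  have h3' := Real.sqrt_nonneg S.eps
  have h4 := S.gap_pos
  have h5 := S.eps_pos
  have h6 := S.inv_eq_gap
  have hp' : (1 : ℝ) ≤ S.pairs n := by exact_mod_cast hp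
  have hpn : (S.pairs n : ℝ) + n 0 ≤ S.N := by
    have := S.pairs_add_le_degree n
    rw [hn] at this
    exact_mod_cast this
  have hc0 : 0 < 1 + S.eps - S.gap := by linarith [gap_le hε]
  have key := bogoliubov_supersolution (ε := S.eps) (σ := Real.sqrt S.eps) (b := S.gap) (N := S.N)
    (n := n 0) (p := S.pairs n / 2) h2 (Nat.cast_nonneg _) (by linarith) (by linarith)
    h3' (Real.sq_sqrt h5.le) h3 h4.le S.gap_sq
  have hD : S.φ * (2 * (S.pairs n / 2) * (S.eps + n 0 / S.N) + (1 + S.eps - S.gap) -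
      Real.sqrt S.eps * S.gap) ≤ S.diagEnergy z n - S.restEnergy n := by
    rw [zMax_eq] at hz
    rw [diagEnergy, kin_eq]
    have : S.φ * (2 * (S.pairs n / 2) * (S.eps + n 0 / S.N)) =
      (S.φ * S.eps + S.φ / S.N * n 0) * S.pairs n := by ring
    linarith
  have hΓ : S.couplingSq n / S.schurLow (S.pairUp n) ≤ S.φ * (n 0 / S.N *
      ((S.pairs n / 2 + 1) ^ 2 * (1 + S.eps - S.gap) / (S.pairs n / 2 + 1 - Real.sqrt S.eps))) := by
    have hden : 0 < (S.pairs n : ℝ) / 2 + 1 - Real.sqrt S.eps := by linarith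
    rcases lt_or_ge (n 0) 2 with h | h
    · rw [S.couplingSq_eq_zero h, zero_div]
      positivity
    · have hn0 : (2 : ℝ) ≤ n 0 := by exact_mod_cast h
      have e : S.schurLow (S.pairUp n) = S.φ * ((n 0 - 1) / S.N *
          ((S.pairs n / 2 + 1 - Real.sqrt S.eps) * (1 + S.eps + S.gap))) := by
        rw [schurLow, S.pairUp_zero h, S.pairs_pairUp h, Nat.cast_sub h]
        push_cast
        ring
      have hn1 : (0 : ℝ) < n 0 - 1 := by linarith
      -- Unequal occupations of j and -j only weaken the coupling, by the arithmetic-geometric mean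
      -- inequality.
      have hab : ((n S.j : ℝ) + 1) * (n (-S.j) + 1) ≤ (S.pairs n / 2 + 1) ^ 2 := by
        rw [pairs]
        push_cast
        nlinarith [sq_nonneg ((n S.j : ℝ) - n (-S.j))]
      rw [e]
      generalize (S.pairs n : ℝ) / 2 + 1 - Real.sqrt S.eps = u at hden ⊢
      rw [div_le_iff₀ (by positivity)]
      calc S.couplingSq n ≤
          (S.φ / S.N) ^ 2 * ((n 0 : ℝ) * (n 0 - 1)) * (S.pairs n / 2 + 1) ^ 2 := by
            unfold couplingSq
            gcongr
        _ = (S.φ / S.N) ^ 2 * ((n 0 : ℝ) * (n 0 - 1)) * (S.pairs n / 2 + 1) ^ 2 *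
            ((1 + S.eps - S.gap) * (1 + S.eps + S.gap)) := by rw [h6, mul_one]
        _ = _ := by field_simp
  refine le_trans ?_ hD
  refine le_trans (add_le_add hΓ le_rfl) ?_
  rw [schurLow, ← mul_add]
  gcongr

-- Induction on eliminated sectors. A larger entry at `pairUp n` means a smaller subtraction at n.
-- In the first sector at most one particle is outside the modes ±j, so the coupling vanishes.
variable {S} in
theorem schurLow_le_schur (hε : S.eps ≤ 1 / 100) {z : ℝ} (hz : z ≤ S.zMax) (k : ℕ) :
    ∀ n : Mode d →₀ ℕ, n.degree = S.N → S.InSector (2 * k) n → 1 ≤ S.pairs n →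
      S.schurLow n ≤ S.schur z k n ∧
        S.diagEnergy z n - S.schur z k n ≤ S.couplingSq n / S.schurLow (S.pairUp n) := by
  induction k with
  | zero =>
    intro n hn hs hp
    have h1 := schurLow_step hε hz hn hp
    have h2 := S.restEnergy_nonneg n
    have hn0 : n 0 < 2 := by
      have := S.pairs_add_le_degree n
      simp only [InSector] at hs
      omega
    rw [S.couplingSq_eq_zero hn0, zero_div] at h1 ⊢
    simp only [schur]
    constructor <;> linarith
  | succ k ih =>
    intro n hn hs hp
    have h1 := schurLow_step hε hz hn hp
    have h2 := S.restEnergy_nonneg n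
    have h3 : S.couplingSq n / S.schur z k (S.pairUp n) ≤
        S.couplingSq n / S.schurLow (S.pairUp n) := by
      rcases lt_or_ge (n 0) 2 with h | h
      · rw [S.couplingSq_eq_zero h, zero_div, zero_div]
      · have hp' : 1 ≤ S.pairs (S.pairUp n) := by rw [S.pairs_pairUp h]; omega
        have h4 := (ih (S.pairUp n) (by rw [S.degree_pairUp h, hn])
          (by simp only [InSector, S.pairs_pairUp h] at hs ⊢; omega) hp').1
        have h5 := schurLow_pos hε hp'
        have h6 := S.couplingSq_nonneg n
        gcongr
    simp only [schur]
    constructor <;> linarith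

/-! ### The operator flow is diagonal -/

theorem isDiag_W_mul_Wstar {T : S.Space →L[ℂ] S.Space} {t : (Mode d →₀ ℕ) → ℝ} (hT : IsDiag T t) :
    IsDiag (S.W * T * S.Wstar) fun n => S.couplingSq n * t (S.pairUp n) := by
  intro ψ n hn
  change amp (S.W (T (S.Wstar ψ))) n = _
  rcases lt_or_ge (n 0) 2 with h | h
  · simp [S.amp_W_zero _ h, S.couplingSq_eq_zero h]
  · obtain ⟨m, rfl⟩ := exists_eq_add_single h
    have hm : (m + Finsupp.single S.j 1 + Finsupp.single (-S.j) 1).degree = S.N := by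
      simp only [map_add, Finsupp.degree_single] at hn ⊢; omega
    rw [amp_W_add, hT _ _ hm, amp_Wstar_add]
    simp only [pairUp_add, ← coupling_mul_self]
    push_cast
    ring

variable {S} in
theorem pairs_pos_of_inSector {k : ℕ} (hk : 2 * k + 2 ≤ S.N) {n : Mode d →₀ ℕ}
    (hs : S.InSector (2 * k) n) : 1 ≤ S.pairs n := by
  simp only [InSector] at hs
  omega

-- A uniform gap is needed, since there are infinitely many configurations. Let D₀ be the diagonal
-- entry without the kinetic energy of the other modes. The numerator is at most D₀ - 2φ/(5N), the
-- denominator is at least D₀, and D₀ is bounded by the constant M, so the quotient is at most 1 -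
-- 2φ/(5NM).
variable {S} in
theorem norm_lt_one_of_isDiag (hε : S.eps ≤ 1 / 100) {z : ℝ} (hz : z ≤ S.zMax) {k : ℕ}
    (hk : 2 * k + 2 ≤ S.N) {T : S.Space →L[ℂ] S.Space}
    (hT : IsDiag T fun n => S.sectorInd (2 * k) n *
      ((S.diagEnergy z n - S.schur z k n) / S.diagEnergy z n)) : ‖T‖ < 1 := by
  have hz0 : z < 0 := hz.trans_lt (zMax_neg hε)
  have hφ := S.φ_pos
  have hN := S.N_cast_pos
  have hε0 := S.eps_pos
  set M : ℝ := S.φ * (1 + S.eps) * S.N - z with hM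
  have hM0 : 0 < M := by
    have : 0 < S.φ * (1 + S.eps) * S.N := by positivity
    linarith
  set q : ℝ := max 0 (1 - S.φ / S.N * (2 / 5) / M) with hq
  have hq1 : q < 1 := max_lt one_pos (by
    have : 0 < S.φ / S.N * (2 / 5) / M := by positivity
    linarith)
  refine lt_of_le_of_lt (hT.norm_le (le_max_left _ _) fun n hn => ?_) hq1
  rcases S.sectorInd_cases (i := 2 * k) n with ⟨hs, h⟩ | ⟨_, h⟩
  · have hp := pairs_pos_of_inSector hk hs
    have hr := S.restEnergy_nonneg n
    obtain ⟨h1, h2⟩ := schurLow_le_schur hε hz k n hn hs hp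
    have h3 := schurLow_step hε hz hn hp
    have h4 := schurLow_ge hε hp
    have h5 := S.diagEnergy_ge z n
    have hbase : 0 < S.diagEnergy z n - S.restEnergy n := by linarith
    have h6 : S.diagEnergy z n - S.restEnergy n ≤ M := by
      have hpn : (S.pairs n : ℝ) + n 0 ≤ S.N := by
        have := S.pairs_add_le_degree n
        rw [hn] at this
        exact_mod_cast this
      have hp0 : (0 : ℝ) ≤ S.pairs n := Nat.cast_nonneg _
      have hn0 : (0 : ℝ) ≤ n 0 := Nat.cast_nonneg _
      have e : S.diagEnergy z n - S.restEnergy n =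
          S.φ * (S.eps + n 0 / S.N) * S.pairs n - z := by rw [diagEnergy, kin_eq]; ring
      have h7 : (n 0 : ℝ) / S.N ≤ 1 := by rw [div_le_one hN]; linarith
      have h8 : (S.pairs n : ℝ) ≤ S.N := by linarith
      rw [e, hM]
      have : S.φ * (S.eps + n 0 / S.N) * S.pairs n ≤ S.φ * (1 + S.eps) * S.N := by
        rw [add_comm 1]
        gcongr
      linarith
    have hΓ0 : 0 ≤ S.diagEnergy z n - S.schur z k n := by
      cases k with
      | zero => simp [schur]
      | succ k =>
        rcases lt_or_ge (n 0) 2 with h' | h'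
        · simp [schur, S.couplingSq_eq_zero h']
        · have hp' : 1 ≤ S.pairs (S.pairUp n) := by rw [S.pairs_pairUp h']; omega
          have h8 := (schurLow_le_schur hε hz k (S.pairUp n) (by rw [S.degree_pairUp h', hn])
            (by simp only [InSector, S.pairs_pairUp h'] at hs ⊢; omega) hp').1
          have h9 := schurLow_pos hε hp'
          simp only [schur, sub_sub_cancel]
          exact div_nonneg (S.couplingSq_nonneg n) (h9.le.trans h8)
    rw [h, one_mul, abs_of_nonneg (div_nonneg hΓ0 (by linarith))]
    refine le_trans ?_ (le_max_right _ _)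
    calc (S.diagEnergy z n - S.schur z k n) / S.diagEnergy z n
        ≤ (S.diagEnergy z n - S.restEnergy n - S.φ / S.N * (2 / 5)) /
          (S.diagEnergy z n - S.restEnergy n) := by
          apply div_le_div₀ <;> linarith
      _ = 1 - S.φ / S.N * (2 / 5) / (S.diagEnergy z n - S.restEnergy n) := by
          rw [sub_div, div_self hbase.ne']
      _ ≤ _ := by gcongr
  · simp [h]

theorem isDiag_mul_R {z : ℝ} (hz : z < 0) {k : ℕ} {G : S.Space →L[ℂ] S.Space}
    (hG : IsDiag G fun n => S.sectorInd (2 * k) n * (S.diagEnergy z n - S.schur z k n)) :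
    IsDiag (G * S.R (2 * k) z) fun n => S.sectorInd (2 * k) n *
        ((S.diagEnergy z n - S.schur z k n) / S.diagEnergy z n) :=
  (hG.mul (S.isDiag_R (2 * k) hz)).congr fun n _ => by
    rcases S.sectorInd_cases (i := 2 * k) n with ⟨_, h⟩ | ⟨_, h⟩
    · simp only [h]; ring
    · simp [h]

-- The Neumann series resums R ∑ (Γ R)^l to (D - Γ)⁻¹. With D - `schur` as the symbol of Γ on the
-- sector, this is the inverse of the Schur entry.
variable {S} in
theorem isDiag_R_mul_tsum (hε : S.eps ≤ 1 / 100) {z : ℝ} (hz : z ≤ S.zMax) {k : ℕ}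
    (hk : 2 * k + 2 ≤ S.N) {G : S.Space →L[ℂ] S.Space}
    (hG : IsDiag G fun n => S.sectorInd (2 * k) n * (S.diagEnergy z n - S.schur z k n)) :
    IsDiag (S.R (2 * k) z * ∑' l : ℕ, (G * S.R (2 * k) z) ^ l) fun n =>
      S.sectorInd (2 * k) n / S.schur z k n := by
  have hz0 : z < 0 := hz.trans_lt (zMax_neg hε)
  have hGR := S.isDiag_mul_R hz0 hG
  refine ((S.isDiag_R (2 * k) hz0).mul
    (hGR.tsum_pow (norm_lt_one_of_isDiag hε hz hk hGR))).congr fun n hn => ?_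
  rcases S.sectorInd_cases (i := 2 * k) n with ⟨hs, h⟩ | ⟨_, h⟩
  · have hD : S.diagEnergy z n ≠ 0 := by
      have := S.neg_le_diagEnergy z n
      exact (by linarith : 0 < S.diagEnergy z n).ne'
    have hp := pairs_pos_of_inSector hk hs
    have h8 := (lt_of_lt_of_le (schurLow_pos hε hp) (schurLow_le_schur hε hz k n hn hs hp).1).ne'
    have h9 : 1 - (S.diagEnergy z n - S.schur z k n) / S.diagEnergy z n =
        S.schur z k n / S.diagEnergy z n := by field_simp; ring
    simp only [h, one_mul, h9]
    field_simp
  · simp [h]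

variable {S} in
theorem isDiag_Gam (hε : S.eps ≤ 1 / 100) {z : ℝ} (hz : z ≤ S.zMax) (k : ℕ)
    (hk : 2 * k + 2 ≤ S.N) :
    IsDiag (S.Gam z k) fun n => S.sectorInd (2 * k) n * (S.diagEnergy z n - S.schur z k n) := by
  induction k with
  | zero =>
    intro ψ n hn
    simp [Gam, schur, amp]
  | succ k ih =>
    have hk' : 2 * k + 2 ≤ S.N := by omega
    have hT := ((S.isDiag_Q (2 * k)).mul (isDiag_R_mul_tsum hε hz hk' (ih hk'))).mul
      (S.isDiag_Q (2 * k))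
    have hA := ((S.isDiag_Q (2 * k + 2)).mul (S.isDiag_W_mul_Wstar hT)).mul (S.isDiag_Q (2 * k + 2))
    have e : S.Gam z (k + 1) = S.Q (2 * k + 2) * (S.W * (S.Q (2 * k) * (S.R (2 * k) z *
        (∑' l : ℕ, (S.Gam z k * S.R (2 * k) z) ^ l)) * S.Q (2 * k)) * S.Wstar) *
          S.Q (2 * k + 2) := by
      simp only [Gam, mul_assoc]
    rw [e]
    refine hA.congr fun n hn => ?_
    rw [show 2 * (k + 1) = 2 * k + 2 from by ring]
    rcases S.sectorInd_cases (i := 2 * k + 2) n with ⟨hs, h⟩ | ⟨_, h⟩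
    · simp only [h, schur, one_mul, mul_one, sub_sub_cancel]
      rcases lt_or_ge (n 0) 2 with h' | h'
      · simp [S.couplingSq_eq_zero h']
      · have hs' : S.InSector (2 * k) (S.pairUp n) := by
          simp only [InSector, S.pairs_pairUp h'] at hs ⊢; omega
        rcases S.sectorInd_cases (i := 2 * k) (S.pairUp n) with ⟨_, h2⟩ | ⟨h2, _⟩
        · simp only [h2, one_mul, mul_one]
          ring
        · exact absurd hs' h2
    · simp [h]

variable {S} in
theorem flowDefined (hε : S.eps ≤ 1 / 100) {z : ℝ} (hz : z ≤ S.zMax) : S.FlowDefined z := by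
  intro i hi hiN
  refine ⟨S.exists_isCompressedResolvent i (hz.trans_lt (zMax_neg hε)), ?_⟩
  obtain ⟨k, rfl⟩ := hi
  have e : (k + k) / 2 = k := by omega
  rw [e, ← two_mul]
  exact summable_geometric_of_norm_lt_one
    (norm_lt_one_of_isDiag hε hz (by omega)
      (S.isDiag_mul_R (hz.trans_lt (zMax_neg hε)) (isDiag_Gam hε hz k (by omega))))

/-! ### The continued fraction for f -/

/-- The configuration with `p` pairs in the modes `±j` and all other particles in the zero mode. -/
noncomputable def chain (p : ℕ) : Mode d →₀ ℕ :=
  Finsupp.single 0 (S.N - 2 * p) + Finsupp.single S.j p + Finsupp.single (-S.j) p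

theorem chain_zero (p : ℕ) : S.chain p 0 = S.N - 2 * p := by
  simp [chain, S.j_ne]

theorem chain_j (p : ℕ) : S.chain p S.j = p := by
  simp [chain, S.j_ne, S.j_ne_neg]

theorem chain_neg_j (p : ℕ) : S.chain p (-S.j) = p := by
  simp [chain, S.j_ne, S.j_ne_neg.symm]

theorem pairs_chain (p : ℕ) : S.pairs (S.chain p) = 2 * p := by
  rw [pairs, chain_j, chain_neg_j, two_mul]

theorem degree_chain {p : ℕ} (hp : 2 * p ≤ S.N) : (S.chain p).degree = S.N := by
  simp only [chain, map_add, Finsupp.degree_single]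
  omega

theorem pairUp_chain {p : ℕ} (hp : 2 * p + 2 ≤ S.N) : S.pairUp (S.chain p) = S.chain (p + 1) := by
  have e : S.chain p = Finsupp.single 0 (S.N - 2 * (p + 1)) + Finsupp.single S.j p +
      Finsupp.single (-S.j) p + Finsupp.single 0 2 := by
    rw [chain, show S.N - 2 * p = S.N - 2 * (p + 1) + 2 from by omega, Finsupp.single_add]
    abel
  rw [e, pairUp_add, chain, Finsupp.single_add, Finsupp.single_add]
  abel

theorem restEnergy_chain (p : ℕ) : S.restEnergy (S.chain p) = 0 := by
  refine Finset.sum_eq_zero fun k hk => ?_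
  simp only [Finset.mem_sdiff, Finset.mem_insert, Finset.mem_singleton, not_or] at hk
  by_cases h : k = 0
  · simp [h, kin]
  · simp [chain, Ne.symm h, Ne.symm hk.2.1, Ne.symm hk.2.2]

theorem diagEnergy_chain (z : ℝ) (p : ℕ) : S.diagEnergy z (S.chain p) =
    S.φ * (2 * p * (S.eps + (S.N - 2 * p : ℕ) / S.N)) - z := by
  rw [diagEnergy, restEnergy_chain, pairs_chain, chain_zero, kin_eq]
  push_cast
  ring

theorem couplingSq_chain (p : ℕ) : S.couplingSq (S.chain p) = S.φ ^ 2 *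
    ((p + 1) ^ 2 * ((S.N - 2 * p : ℕ) * ((S.N - 2 * p : ℕ) - 1)) / (S.N : ℝ) ^ 2) := by
  rw [couplingSq, chain_zero, chain_j, chain_neg_j]
  ring

-- The last step of the flow acts on η alone, whose diagonal entry is -z: it has no pairs and no
-- kinetic energy. Thus f is one further step of the same recursion.
variable {S} in
theorem f_eq_schur (hε : S.eps ≤ 1 / 100) {z : ℝ} (hz : z ≤ S.zMax) {K : ℕ}
    (hK : 2 * K + 2 = S.N) : S.f z = S.schur z (K + 1) (S.chain 0) := by
  classical
  have h1 := S.isDiag_W_mul_Wstar (isDiag_R_mul_tsum hε hz hK.le (isDiag_Gam hε hz K hK.le))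
  have e1 : S.N - 2 = 2 * K := by omega
  have hdeg : (S.chain 0).degree = S.N := S.degree_chain (by omega)
  have h2 : 2 ≤ S.chain 0 0 := by rw [chain_zero]; omega
  have hs : S.InSector (2 * K) (S.pairUp (S.chain 0)) := by
    rw [InSector, S.pairs_pairUp h2, pairs_chain]; omega
  have hchain : S.chain 0 = Finsupp.single 0 S.N := by simp [chain]
  have h3 : S.sectorInd (2 * K) (S.pairUp (S.chain 0)) = 1 := by simp [sectorInd, hs]
  have h4 : S.eta = lp.single 2 (⟨S.chain 0, hdeg⟩ : Occ d S.N) (1 : ℂ) := by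
    rw [eta]
    congr 1
    exact Subtype.ext hchain.symm
  rw [f, e1, show 2 * K / 2 = K by omega, mul_assoc S.W, h4, ← amp_eq_inner, h1 _ _ hdeg,
    amp_single, if_pos rfl, schur, diagEnergy_chain]
  simp only [h3]
  rw [mul_one, Complex.ofReal_re]
  simp
  ring

/-! ### Monotonicity and continuity in z -/

variable {S} in
theorem schur_pairUp_pos (hε : S.eps ≤ 1 / 100) {z : ℝ} (hz : z ≤ S.zMax) {k : ℕ}
    {n : Mode d →₀ ℕ} (hn : n.degree = S.N) (hs : S.InSector (2 * (k + 1)) n) (h : 2 ≤ n 0) :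
    0 < S.schur z k (S.pairUp n) := by
  have hp : 1 ≤ S.pairs (S.pairUp n) := by rw [S.pairs_pairUp h]; omega
  refine (schurLow_pos hε hp).trans_le (schurLow_le_schur hε hz k _ ?_ ?_ hp).1
  · rw [S.degree_pairUp h, hn]
  · simp only [InSector, S.pairs_pairUp h] at hs ⊢; omega

-- The diagonal entry has slope -1 in z, and the subtracted quotient increases as the entry below it
-- decreases; hence every Schur entry has slope at most -1.
variable {S} in
theorem schur_add_le (hε : S.eps ≤ 1 / 100) {z z' : ℝ} (hzz : z ≤ z') (hz : z' ≤ S.zMax) (k : ℕ) :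
    ∀ n : Mode d →₀ ℕ, n.degree = S.N → S.InSector (2 * k) n →
      S.schur z' k n + (z' - z) ≤ S.schur z k n := by
  induction k with
  | zero =>
    intro n _ _
    simp only [schur, diagEnergy]
    linarith
  | succ k ih =>
    intro n hn hs
    have h1 : S.couplingSq n / S.schur z k (S.pairUp n) ≤
        S.couplingSq n / S.schur z' k (S.pairUp n) := by
      rcases lt_or_ge (n 0) 2 with h | h
      · simp [S.couplingSq_eq_zero h]
      · have h2 := schur_pairUp_pos hε hz hn hs h
        have h3 := ih (S.pairUp n) (by rw [S.degree_pairUp h, hn])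
          (by simp only [InSector, S.pairs_pairUp h] at hs ⊢; omega)
        have h4 := S.couplingSq_nonneg n
        gcongr
        linarith
    simp only [schur, diagEnergy] at h1 ⊢
    linarith

variable {S} in
theorem continuousOn_schur (hε : S.eps ≤ 1 / 100) (k : ℕ) :
    ∀ n : Mode d →₀ ℕ, n.degree = S.N → S.InSector (2 * k) n →
      ContinuousOn (fun z => S.schur z k n) (Set.Iic S.zMax) := by
  have hD : ∀ n, ContinuousOn (fun z => S.diagEnergy z n) (Set.Iic S.zMax) := fun n => by
    unfold diagEnergy
    fun_prop
  induction k with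
  | zero => exact fun n _ _ => hD n
  | succ k ih =>
    intro n hn hs
    refine (hD n).sub ?_
    rcases lt_or_ge (n 0) 2 with h | h
    · simp only [S.couplingSq_eq_zero h, zero_div]
      exact continuousOn_const
    · refine continuousOn_const.div (ih (S.pairUp n) (by rw [S.degree_pairUp h, hn])
          (by simp only [InSector, S.pairs_pairUp h] at hs ⊢; omega)) fun z hz => ?_
      exact (schur_pairUp_pos hε hz hn hs h).ne'

/-! ### The sign of f at the two ends -/

variable {S} in
theorem le_schur_EBog (hε : S.eps ≤ 1 / 100) (k : ℕ) : ∀ p : ℕ, 2 * k + 2 * p = S.N →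
    S.φ * (((S.N - 2 * p : ℕ) + 1) / S.N * (p * (1 + S.eps + S.gap))) ≤
      S.schur S.EBog k (S.chain p) := by
  have h1 := S.φ_pos
  have h2 := S.N_cast_pos
  have h4 := S.gap_pos
  have h5 := S.eps_pos
  have h6 := S.inv_eq_gap
  have hc0 : 0 < 1 + S.eps - S.gap := by linarith [gap_le hε]
  have key : ∀ p : ℕ, 2 * p ≤ S.N → S.φ * ((S.N - 2 * p : ℕ) / S.N *
      ((p + 1) * (1 + S.eps - S.gap))) + S.φ * (((S.N - 2 * p : ℕ) + 1) / S.N *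
        (p * (1 + S.eps + S.gap))) ≤ S.diagEnergy S.EBog (S.chain p) := fun p hp => by
    have hpn : 2 * (p : ℝ) + (S.N - 2 * p : ℕ) ≤ S.N := by
      have : 2 * p + (S.N - 2 * p) ≤ S.N := by omega
      exact_mod_cast this
    have := bogoliubov_supersolution_even (N := S.N) (n := (S.N - 2 * p : ℕ)) h2
      (Nat.cast_nonneg _) (Nat.cast_nonneg p) hpn h5.le hε h4.le S.gap_sq
    rw [diagEnergy_chain, EBog_eq, sub_neg_eq_add, ← mul_add, ← mul_add]
    gcongr
  induction k with
  | zero =>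
    intro p hp
    refine le_trans ?_ (key p (by omega))
    have : 0 ≤ S.φ * ((S.N - 2 * p : ℕ) / S.N * ((p + 1) * (1 + S.eps - S.gap))) := by positivity
    linarith
  | succ k ih =>
    intro p hp
    have h7 := ih (p + 1) (by omega)
    have h8 := key p (by omega)
    have ht : S.N - 2 * p = (S.N - 2 * (p + 1)) + 2 := by omega
    -- On the chain j and -j are equally occupied, so the coupling is exactly the product of the two
    -- bounds, by (1+ε-b)(1+ε+b) = 1.
    have h9 : S.couplingSq (S.chain p) / S.schur S.EBog k (S.chain (p + 1)) ≤
        S.φ * ((S.N - 2 * p : ℕ) / S.N * ((p + 1) * (1 + S.eps - S.gap))) := by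
      have h10 := S.couplingSq_nonneg (S.chain p)
      have h11 : 0 < S.φ * (((S.N - 2 * (p + 1) : ℕ) + 1) / S.N *
          ((p + 1 : ℕ) * (1 + S.eps + S.gap))) := by positivity
      refine (div_le_div_of_nonneg_left h10 h11 h7).trans ?_
      rw [div_le_iff₀ h11, couplingSq_chain, ht]
      push_cast
      generalize ((S.N - 2 * (p + 1) : ℕ) : ℝ) = t
      have e : S.φ * ((t + 2) / S.N * ((p + 1) * (1 + S.eps - S.gap))) *
          (S.φ * ((t + 1) / S.N * ((p + 1) * (1 + S.eps + S.gap)))) =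
          S.φ ^ 2 * ((p + 1) ^ 2 * ((t + 2) * (t + 1)) / S.N ^ 2) *
            ((1 + S.eps - S.gap) * (1 + S.eps + S.gap)) := by ring
      rw [e, h6, mul_one]
      apply le_of_eq
      ring
    rw [schur, S.pairUp_chain (by omega)]
    linarith

/-- An upper bound, in units of `φ`, for the distance between the fixed point and `EBog`. -/
noncomputable def shift : ℝ := 2 / S.N + 3 / (S.N * S.gap) * (1 + S.eps - S.gap)

-- The recursion is monotone, so an upper bound at p + 1 passes to p. Positivity of the entry at p +
-- 1, needed to divide, comes from the lower bound below `zMax`; hence the hypothesis on the shifted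
-- energy.
variable {S} in
theorem schur_le (hε : S.eps ≤ 1 / 100) (hz : S.EBog + S.φ * S.shift ≤ S.zMax) (k : ℕ) :
    ∀ p : ℕ, 2 * k + 2 * p = S.N → S.schur (S.EBog + S.φ * S.shift) k (S.chain p) ≤
      S.φ * ((1 + 3 / (S.N * S.gap)) * (p * (1 + S.eps + S.gap))) := by
  have h1 := S.φ_pos
  have h2 := S.N_cast_pos
  have h4 := S.gap_pos
  have h5 := S.eps_pos
  have key : ∀ p : ℕ, 2 * p ≤ S.N → S.diagEnergy (S.EBog + S.φ * S.shift) (S.chain p) ≤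
      S.φ * ((1 + 3 / (S.N * S.gap)) * (p * (1 + S.eps + S.gap))) + S.couplingSq (S.chain p) /
        (S.φ * ((1 + 3 / (S.N * S.gap)) * ((p + 1) * (1 + S.eps + S.gap)))) := fun p hp => by
    have hpn : 2 * (p : ℝ) + (S.N - 2 * p : ℕ) = S.N := by
      have : 2 * p + (S.N - 2 * p) = S.N := by omega
      exact_mod_cast this
    have h6 := mul_le_mul_of_nonneg_left
      (bogoliubov_subsolution h2 (Nat.cast_nonneg p) hpn h4 h5.le S.gap_sq) h1.le
    have h7 : ∀ A B : ℝ, S.φ ^ 2 * A / (S.φ * B) = S.φ * (A / B) := fun A B => by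
      rw [pow_two, mul_assoc, mul_div_mul_left _ _ h1.ne', mul_div_assoc]
    rw [couplingSq_chain, h7, diagEnergy_chain, EBog_eq, shift]
    refine le_trans (le_of_eq ?_) (h6.trans_eq (mul_add _ _ _))
    ring
  induction k with
  | zero =>
    intro p hp
    have h6 := key p (by omega)
    rwa [S.couplingSq_eq_zero (by rw [chain_zero]; omega), zero_div, add_zero] at h6
  | succ k ih =>
    intro p hp
    have h6 := key p (by omega)
    have h7 := ih (p + 1) (by omega)
    have h8 : 0 < S.schur (S.EBog + S.φ * S.shift) k (S.chain (p + 1)) := by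
      rw [← S.pairUp_chain (by omega)]
      refine schur_pairUp_pos hε hz (S.degree_chain (by omega)) ?_ ?_
      · rw [InSector, pairs_chain]; omega
      · rw [chain_zero]; omega
    have h9 := div_le_div_of_nonneg_left (S.couplingSq_nonneg (S.chain p)) h8 h7
    rw [schur, S.pairUp_chain (by omega)]
    push_cast at h9
    linarith

/-! ### The fixed point -/

variable {S} in
theorem hasFixedPoint_and_bounds (hε : S.eps ≤ 1 / 100)
    (hz : S.EBog + S.φ * S.shift ≤ S.zMax) :
    S.HasFixedPoint ∧ S.EBog ≤ S.zStar ∧ S.zStar ≤ S.EBog + S.φ * S.shift := by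
  obtain ⟨K, hK⟩ : ∃ K, 2 * K + 2 = S.N := by
    have := S.N_pos
    obtain ⟨k, hk⟩ := S.N_even
    exact ⟨k - 1, by omega⟩
  have hf : ∀ z ≤ S.zMax, S.f z = S.schur z (K + 1) (S.chain 0) := fun z hz => f_eq_schur hε hz hK
  have hdeg : (S.chain 0).degree = S.N := S.degree_chain (by omega)
  have hs : S.InSector (2 * (K + 1)) (S.chain 0) := by rw [InSector, pairs_chain]; omega
  have hshift : 0 ≤ S.φ * S.shift := by
    have h1 := S.φ_pos
    have h2 := S.N_cast_pos
    have h4 := S.gap_pos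
    have h5 := S.eps_pos
    have hc0 : 0 < 1 + S.eps - S.gap := by linarith [gap_le hε]
    unfold shift
    positivity
  have hlow : 0 ≤ S.f S.EBog := by
    rw [hf _ S.EBog_le_zMax]
    -- At p = 0 the bound carries the factor p and is zero; the same happens at the upper end.
    simpa using le_schur_EBog hε (K + 1) 0 (by omega)
  have hup : S.f (S.EBog + S.φ * S.shift) ≤ 0 := by
    rw [hf _ hz]
    simpa using schur_le hε hz (K + 1) 0 (by omega)
  have hcont : ContinuousOn S.f (Set.Icc S.EBog (S.EBog + S.φ * S.shift)) :=
    ((continuousOn_schur hε (K + 1) _ hdeg hs).mono fun z h => h.2.trans hz).congr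
      fun z h => hf z (h.2.trans hz)
  obtain ⟨z₀, hz₀, hz₀f⟩ := intermediate_value_Icc' (by linarith) hcont ⟨hup, hlow⟩
  have hfix : S.IsFixedPoint z₀ := ⟨hz₀.2.trans hz, hz₀f⟩
  have hanti : ∀ z z', z < z' → z' ≤ S.zMax → S.f z' < S.f z := fun z z' h h' => by
    rw [hf z (h.le.trans h'), hf z' h']
    have := schur_add_le hε h.le h' (K + 1) _ hdeg hs
    linarith
  have huniq : ∀ z, S.IsFixedPoint z → z = z₀ := fun z h => by
    rcases lt_trichotomy z z₀ with h' | h' | h'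
    · have := hanti _ _ h' hfix.1
      rw [h.2, hfix.2] at this
      exact absurd this (lt_irrefl _)
    · exact h'
    · have := hanti _ _ h' h.1
      rw [h.2, hfix.2] at this
      exact absurd this (lt_irrefl _)
  have hstar : S.zStar = z₀ := huniq _ (Classical.epsilon_spec ⟨z₀, hfix⟩)
  rw [hstar]
  exact ⟨⟨fun z h => flowDefined hε h, z₀, hfix, huniq⟩, hz₀⟩

-- Both terms of `shift` are compared with 1/(N√ε), using √ε ≤ 1 and √ε ≤ `gap`, which gives 5 = 2 +
-- 3. The hypothesis then says 5/(N√ε) ≤ ε ≤ √ε `gap`, the distance from E^Bog to `zMax` in units of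
-- φ.
variable {S} in
theorem hasFixedPoint_of_small (hε : S.eps ≤ 1 / 100)
    (hN : 1 / (S.N : ℝ) ≤ 1 / 5 * (S.eps * Real.sqrt S.eps)) :
    S.HasFixedPoint ∧ |S.zStar - S.EBog| ≤ S.φ * (5 / (S.N * Real.sqrt S.eps)) := by
  have h1 := S.φ_pos
  have h2 := S.N_cast_pos
  have h4 := S.gap_pos
  have h5 := S.eps_pos
  have h6 : 0 < Real.sqrt S.eps := Real.sqrt_pos.2 h5
  have h7 := S.sqrt_eps_le_gap
  have hc1 : 1 + S.eps - S.gap ≤ 1 := by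
    have := S.gap_sq
    nlinarith
  have hc0 : 0 < 1 + S.eps - S.gap := by linarith [gap_le hε]
  have hσ := sqrt_eps_le hε
  have hsh : S.shift ≤ 5 / (S.N * Real.sqrt S.eps) := by
    have a1 : 2 / (S.N : ℝ) ≤ 2 / (S.N * Real.sqrt S.eps) := by
      gcongr
      nlinarith
    have a2 : 3 / (S.N * S.gap) * (1 + S.eps - S.gap) ≤ 3 / (S.N * Real.sqrt S.eps) * 1 := by
      gcongr
    rw [shift]
    calc _ ≤ 2 / (S.N * Real.sqrt S.eps) + 3 / (S.N * Real.sqrt S.eps) * 1 := add_le_add a1 a2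
      _ = _ := by ring
  have hsm : 5 / (S.N * Real.sqrt S.eps) ≤ Real.sqrt S.eps * S.gap := by
    calc 5 / (S.N * Real.sqrt S.eps) = 5 * (1 / S.N) / Real.sqrt S.eps := by field_simp
      _ ≤ 5 * (1 / 5 * (S.eps * Real.sqrt S.eps)) / Real.sqrt S.eps := by gcongr
      _ = Real.sqrt S.eps * Real.sqrt S.eps := by
        rw [Real.mul_self_sqrt h5.le]; field_simp
      _ ≤ _ := by gcongr
  have hz : S.EBog + S.φ * S.shift ≤ S.zMax := by
    have := mul_le_mul_of_nonneg_left (hsh.trans hsm) h1.le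
    rw [zMax, ← gap]
    linarith
  obtain ⟨hfix, hl, hu⟩ := hasFixedPoint_and_bounds hε hz
  refine ⟨hfix, ?_⟩
  rw [abs_of_nonneg (by linarith)]
  have := mul_le_mul_of_nonneg_left hsh h1.le
  linarith

/-! ### Scaling of ε and the limits -/

theorem eps_eq_div (S : ThreeModeSystem d) :
    S.eps = (∑ i, (2 * Real.pi * (S.j i : ℝ)) ^ 2) / S.φ / S.L ^ 2 := by
  have : S.kin S.j = (∑ i, (2 * Real.pi * (S.j i : ℝ)) ^ 2) / S.L ^ 2 := by
    rw [kin, Finset.sum_div]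
    refine Finset.sum_congr rfl fun i _ => ?_
    ring
  rw [eps, this]
  ring

theorem hasFixedPoint_of_gammaCondition {S : ThreeModeSystem d} (hε : S.eps ≤ 1 / 100) {γ : ℝ}
    (h : S.GammaCondition γ (1 / 5)) :
    S.HasFixedPoint ∧ |S.zStar - S.EBog| ≤ S.φ * (5 / (S.N * Real.sqrt S.eps)) := by
  refine hasFixedPoint_of_small hε ?_
  have h1 := S.eps_pos
  have h2 : 0 ≤ S.eps ^ 2 + S.eps / (S.N : ℝ) ^ γ := by positivity
  linarith [h.1]

theorem tendsto_zStar_of_eventually {S : ℕ → ThreeModeSystem d} {B : ℕ → ℝ}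
    (hε : ∀ᶠ n in atTop, (S n).eps ≤ 1 / 100)
    (hN : ∀ᶠ n in atTop, 1 / ((S n).N : ℝ) ≤ 1 / 5 * ((S n).eps * Real.sqrt (S n).eps))
    (hB : ∀ᶠ n in atTop, (S n).φ * (5 / ((S n).N * Real.sqrt (S n).eps)) ≤ B n)
    (hB0 : Tendsto B atTop (𝓝 0)) :
    (∀ᶠ n in atTop, (S n).HasFixedPoint) ∧
      Tendsto (fun n => (S n).zStar - (S n).EBog) atTop (𝓝 0) := by
  constructor
  · filter_upwards [hε, hN] with n h1 h2
    exact (hasFixedPoint_of_small h1 h2).1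
  · refine squeeze_zero_norm' ?_ hB0
    filter_upwards [hε, hN, hB] with n h1 h2 h3
    exact (hasFixedPoint_of_small h1 h2).2.trans h3

theorem meanField_limit (S : ℕ → ThreeModeSystem d) (S₀ : ThreeModeSystem d)
    (hS : ∀ n, (S n).L = S₀.L ∧ (S n).j = S₀.j ∧ (S n).φ = S₀.φ) (hε : S₀.eps ≤ 1 / 100)
    (hN : Tendsto (fun n => (S n).N) atTop atTop) :
    (∀ᶠ n in atTop, (S n).HasFixedPoint) ∧ Tendsto (fun n => (S n).zStar) atTop (𝓝 S₀.EBog) := by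
  have he : ∀ n, (S n).eps = S₀.eps := fun n => by
    rw [eps_eq_div, eps_eq_div, (hS n).1, (hS n).2.1, (hS n).2.2]
  have hE : ∀ n, (S n).EBog = S₀.EBog := fun n => by
    rw [EBog_eq, EBog_eq, gap, gap, he, (hS n).2.2]
  have h0 := S₀.eps_pos
  have hs : 0 < Real.sqrt S₀.eps := Real.sqrt_pos.2 h0
  have hlim : Tendsto (fun n => 1 / ((S n).N : ℝ)) atTop (𝓝 0) :=
    tendsto_one_div_atTop_nhds_zero_nat.comp hN
  have hB0 : Tendsto (fun n => S₀.φ * 5 / Real.sqrt S₀.eps * (1 / ((S n).N : ℝ))) atTop (𝓝 0) := by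
    simpa using hlim.const_mul (S₀.φ * 5 / Real.sqrt S₀.eps)
  have hpos : 0 < 1 / 5 * (S₀.eps * Real.sqrt S₀.eps) := by positivity
  obtain ⟨h1, h2⟩ := tendsto_zStar_of_eventually (S := S) (Eventually.of_forall fun n => by rwa [he])
    (by
      filter_upwards [hlim.eventually (gt_mem_nhds hpos)] with n hn
      rw [he]
      exact hn.le)
    (Eventually.of_forall fun n => by
      rw [he, (hS n).2.2]
      apply le_of_eq
      ring) hB0
  refine ⟨h1, ?_⟩
  simpa [hE] using h2.add_const S₀.EBog

/-- Here ε = a/L² and N = ρL^d. The smallness condition compares 1/N with L⁻³, which is where d ≥ 4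
enters; the error is of order 1/(N√ε), and this is O(1/L). -/
theorem fixedDensity_limit (hd : 4 ≤ d) (ρ φ₀ : ℝ) (j₀ : Fin d → ℤ) (S : ℕ → ThreeModeSystem d)
    (hS : ∀ n, (S n).density = ρ ∧ (S n).j = j₀ ∧ (S n).φ = φ₀)
    (hL : Tendsto (fun n => (S n).L) atTop atTop) :
    (∀ᶠ n in atTop, (S n).HasFixedPoint) ∧
      Tendsto (fun n => (S n).zStar - (S n).EBog) atTop (𝓝 0) := by
  set a : ℝ := (∑ i, (2 * Real.pi * (j₀ i : ℝ)) ^ 2) / φ₀ with ha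
  have he : ∀ n, (S n).eps = a / (S n).L ^ 2 := fun n => by
    rw [eps_eq_div, (hS n).2.1, (hS n).2.2]
  have ha0 : 0 < a := by
    have h1 := (S 0).eps_pos
    have h2 := (S 0).L_pos
    rw [he, div_pos_iff_of_pos_right (by positivity)] at h1
    exact h1
  have hρ : 0 < ρ := by
    have h1 := (S 0).N_cast_pos
    have h2 := (S 0).L_pos
    rw [← (hS 0).1, density]
    positivity
  have hφ : 0 < φ₀ := by
    rw [← (hS 0).2.2]
    exact (S 0).φ_pos
  have hsa : 0 < Real.sqrt a := Real.sqrt_pos.2 ha0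
  have hse : ∀ n, Real.sqrt (S n).eps = Real.sqrt a / (S n).L := fun n => by
    rw [he, Real.sqrt_div ha0.le, Real.sqrt_sq (S n).L_pos.le]
  have hN : ∀ n, 1 ≤ (S n).L → ρ * (S n).L ^ 4 ≤ (S n).N := fun n h => by
    have h1 : ((S n).N : ℝ) = ρ * (S n).L ^ d := by
      have := (S n).L_pos
      rw [← (hS n).1, density]
      field_simp
    rw [h1]
    gcongr
  have hB0 : Tendsto (fun n => φ₀ * (5 / (ρ * Real.sqrt a)) / (S n).L) atTop (𝓝 0) :=
    hL.const_div_atTop _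
  refine tendsto_zStar_of_eventually ?_ ?_ ?_ hB0
  · filter_upwards [hL.eventually_ge_atTop 1, hL.eventually_ge_atTop (100 * a)] with n h1 h2
    rw [he, div_le_iff₀ (by positivity)]
    nlinarith
  · filter_upwards [hL.eventually_ge_atTop 1,
      hL.eventually_ge_atTop (5 / (ρ * (a * Real.sqrt a)))] with n h1 h2
    have h3 : 0 < (S n).L := by linarith
    rw [hse, he]
    calc 1 / ((S n).N : ℝ) ≤ 1 / (ρ * (S n).L ^ 4) :=
          one_div_le_one_div_of_le (by positivity) (hN n h1)
      _ ≤ _ := by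
        rw [div_le_iff₀ (by positivity)] at h2
        rw [div_le_iff₀ (by positivity)]
        field_simp
        linarith
  · filter_upwards [hL.eventually_ge_atTop 1] with n h1
    have h3 : 0 < (S n).L := by linarith
    have h4 := hN n h1
    have h5 : ρ * Real.sqrt a * (S n).L ≤ (S n).N * (Real.sqrt a / (S n).L) := by
      calc ρ * Real.sqrt a * (S n).L ≤ ρ * Real.sqrt a * (S n).L ^ 3 := by
            gcongr
            exact le_self_pow₀ h1 (by norm_num)
        _ = ρ * (S n).L ^ 4 * (Real.sqrt a / (S n).L) := by field_simp
        _ ≤ _ := by gcongr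
    rw [hse, (hS n).2.2, mul_div_assoc, div_div]
    gcongr

end ThreeModeSystem

/-! ### The main theorem -/

theorem mainTheorem4 :
    (∃ c > (0 : ℝ), ∃ C > (0 : ℝ), ∀ γ : ℝ, 0 < γ → γ < 1 →
      ∃ ε₀ > (0 : ℝ), ∃ kγ > (0 : ℝ),
        (∀ (d : ℕ) (S : ThreeModeSystem d), S.eps ≤ ε₀ → S.GammaCondition γ kγ →
          S.HasFixedPoint) ∧
        ∀ β : ℝ, 0 < β → β < 1 → ∃ τ > (0 : ℝ),
          ∀ (d : ℕ) (S : ThreeModeSystem d), S.eps ≤ ε₀ → S.GammaCondition γ kγ →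
            1 / (S.N : ℝ) ^ β ≤ τ * S.eps →
            1 / (S.N : ℝ) ^ (1 - β) ≤ τ * Real.sqrt S.eps →
            |S.zStar - S.EBog| ≤ C * S.φ *
              (1 / (S.eps * (S.N : ℝ) ^ β) +
                1 / Real.sqrt S.eps *
                  (1 / (1 + c * Real.sqrt S.eps)) ^ ((S.N : ℝ) ^ (1 - β)) +
                1 / (S.N : ℝ))) ∧
    (∃ ε₀ > (0 : ℝ), ∀ (d : ℕ) (S : ℕ → ThreeModeSystem d) (S₀ : ThreeModeSystem d),
      (∀ n, (S n).L = S₀.L ∧ (S n).j = S₀.j ∧ (S n).φ = S₀.φ) → S₀.eps ≤ ε₀ →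
      Tendsto (fun n => (S n).N) atTop atTop →
      (∀ᶠ n in atTop, (S n).HasFixedPoint) ∧
        Tendsto (fun n => (S n).zStar) atTop (𝓝 S₀.EBog)) ∧
    (∀ d : ℕ, 4 ≤ d → ∀ (ρ φ₀ : ℝ) (j₀ : Fin d → ℤ) (S : ℕ → ThreeModeSystem d),
      (∀ n, (S n).density = ρ ∧ (S n).j = j₀ ∧ (S n).φ = φ₀) →
      Tendsto (fun n => (S n).L) atTop atTop →
      (∀ᶠ n in atTop, (S n).HasFixedPoint) ∧
        Tendsto (fun n => (S n).zStar - (S n).EBog) atTop (𝓝 0)) := by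
  -- C = 5 is the constant in the error 5φ/(N√ε). Since ε N^β ≤ N√ε, the first term of the bound
  -- suffices, so c = 1 and τ = 1 are arbitrary choices.
  refine ⟨⟨1, one_pos, 5, by norm_num, fun γ _ _ => ⟨1 / 100, by norm_num, 1 / 5, by norm_num,
    fun d S hε h => (ThreeModeSystem.hasFixedPoint_of_gammaCondition hε h).1,
    fun β _ hβ => ⟨1, one_pos, fun d S hε h _ _ => ?_⟩⟩⟩,
    ⟨1 / 100, by norm_num, fun d S S₀ hS hε hN => ThreeModeSystem.meanField_limit S S₀ hS hε hN⟩,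
    fun d hd ρ φ₀ j₀ S hS hL => ThreeModeSystem.fixedDensity_limit hd ρ φ₀ j₀ S hS hL⟩
  have h1 := S.φ_pos
  have h2 := S.N_cast_pos
  have h5 := S.eps_pos
  have h6 : 0 < Real.sqrt S.eps := Real.sqrt_pos.2 h5
  have hN1 : (1 : ℝ) ≤ S.N := by exact_mod_cast S.N_pos
  have h7 : S.eps * (S.N : ℝ) ^ β ≤ S.N * Real.sqrt S.eps := by
    have e1 : (S.N : ℝ) ^ β ≤ S.N := Real.rpow_le_self_of_one_le hN1 hβ.le
    have e2 : S.eps ≤ Real.sqrt S.eps := Real.le_sqrt_of_sq_le (by nlinarith)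
    rw [mul_comm]
    gcongr
  have h8 : 0 ≤ 1 / Real.sqrt S.eps *
      (1 / (1 + 1 * Real.sqrt S.eps)) ^ ((S.N : ℝ) ^ (1 - β)) + 1 / (S.N : ℝ) := by positivity
  refine (ThreeModeSystem.hasFixedPoint_of_gammaCondition hε h).2.trans ?_
  rw [mul_comm 5 S.φ, mul_assoc]
  gcongr
  calc 5 / (S.N * Real.sqrt S.eps) ≤ 5 / (S.eps * (S.N : ℝ) ^ β) := by gcongr
    _ = 5 * (1 / (S.eps * (S.N : ℝ) ^ β)) := by ring
    _ ≤ _ := by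
      gcongr
      linarith
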